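/- **Setting.** A *weak $C^*$-Hopf algebra* is a finite dimensional unital $C^*$-algebra $\mathcal A$ with linear maps $\Delta:\mathcal A\to\mathcal A\otimes\mathcal A$, $\varepsilon:\mathcal A\to\mathbb C$, $S:\mathcal A\to\mathcal A$ such that $(\Delta,\varepsilon)$ is coassociative and counital and, in Sweedler notation, for all $x,y,z\in\mathcal A$: $\Delta(xy)=\Delta(x)\Delta(y)$; $\Delta(x^*)=\Delta(x)^*$; $(\Delta(1)\otimes1)(1\otimes\Delta(1))=1_{(1)}\otimes1_{(2)}\otimes1_{(3)}$; $\varepsilon(xyz)=\varepsilon(xy_{(1)})\varepsilon(y_{(2)}z)$; $S(x_{(1)})x_{(2)}=1_{(1)}\varepsilon(x1_{(2)})$; $x_{(1)}S(x_{(2)})=\varepsilon(1_{(1)}x)1_{(2)}$; $S(x_{(1)})x_{(2)}S(x_{(3)})=S(x)$. Put $\mathcal A_L=\{(\varphi\otimes\mathrm{id})\Delta(1):\varphi\in\hat{\mathcal A}\}$ and $\mathcal A_R=\{(\mathrm{id}\otimes\varphi)\Delta(1):\varphi\in\hat{\mathcal A}\}$, where $\hat{\mathcal A}$ is the dual space of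 $\mathcal A$ with product $(\varphi\psi)(a)=\varphi(a_{(1)})\psi(a_{(2)})$, unit $\hat 1=\varepsilon$, coproduct $\langle\hat\Delta\varphi,a\otimes b\rangle=\varphi(ab)$ and antipode $\hat S\varphi=\varphi\circ S$. Write $\varphi\rightharpoonup a=a_{(1)}\varphi(a_{(2)})$. An element $l\in\mathcal A$ is a *left* (*right*) *integral* if $al=a_{(1)}S(a_{(2)})l$ (resp. $la=lS(a_{(1)})a_{(2)}$) for all $a\in\mathcal A$; left integrals of $\hat{\mathcal A}$ are defined in the same way, and $\mathcal L(\hat{\mathcal A})$ is the space of these. The *normalized Haar integral* $h\in\mathcal A$ is the left and right integral with $S(h_{(1)})h_{(2)}=h_{(1)}S(h_{(2)})=1$, and $\lambda_h\in\mathcal L(\hat{\mathcal A})$, its *dual left integral*, is the left integral with $\lambda_h\rightharpoonup h=1$. An *$\mathcal A$-module algebra* is a unital complex $*$-algebra $\mathcal M$ with a bilinear action $\triangleright$ of $\mathcal A$ such that $(ab)\triangleright m=a\triangleright(b\triangleright m)$, $1\triangleright m=m$, $a\triangleright(mn)=(a_{(1)}\triangleright m)(a_{(2)}\triangleright n)$,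 $(a\triangleright m)^*=S(a)^*\triangleright m^*$ and $a\triangleright1=(a_{(1)}S(a_{(2)}))\triangleright1$. The *crossed product* $\mathcal M\rtimes\mathcal A$ is $\mathcal M\otimes\mathcal A$ modulo the relations $m(b\triangleright1)\otimes a=m\otimes ba$ $(b\in\mathcal A_L)$, with product $(m\rtimes a)(n\rtimes b)=m(a_{(1)}\triangleright n)\rtimes a_{(2)}b$; identify $m$ with $m\rtimes1$, and write $a$ for $1\rtimes a$. Let $C(\mathcal M)$ be the center of $\mathcal M$, let $\mathcal M'\cap(\mathcal M\rtimes\mathcal A)$ be the relative commutant, and let $C(\mathcal M)\rtimes\mathcal A_R$ be the span of all $z\rtimes b$ with $z\in C(\mathcal M)$, $b\in\mathcal A_R$. Identify $\mathcal M\otimes\hat{\mathcal A}=\mathrm{Hom}_{\mathbb C}(\mathcal A,\mathcal M)$ and let $\hat\rho(m)\in\mathcal M\otimes\hat{\mathcal A}$ be $\hat\rho(m)(a)=a\triangleright m$. An *inner implementer* is a $T\in\mathcal M\otimes\hat{\mathcal A}$ with $T(m\otimes\hat1)=\hat\rho(m)T$ for all $m\in\mathcal M$, i.e. $T(a)m=(a_{(1)}\triangleright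 m)T(a_{(2)})$ for all $a\in\mathcal A$, $m\in\mathcal M$. They form a $C(\mathcal M)$-module $\mathcal T(\mathcal M)$ under $(zT)(a)=zT(a)$. The *trivial* ones are those in $\mathcal T^0(\mathcal M)=\hat\rho(1)(1\otimes\mathcal L(\hat{\mathcal A}))$. The action is *outer* if $\mathcal T(\mathcal M)=C(\mathcal M)\mathcal T^0(\mathcal M)$ (the $C(\mathcal M)$-span). **Theorem (Outer actions).** Let $\mathcal A$ be a weak $C^*$-Hopf algebra and $\mathcal M$ an $\mathcal A$-module algebra. The normalized Haar integral $h$ and its dual left integral $\lambda_h$ exist and are unique. Let $\hat E:\mathcal M\rtimes\mathcal A\to\mathcal M$ be given by $\hat E(m\rtimes a)=m\,((\lambda_h\rightharpoonup a)\triangleright1)$, and for $x\in\mathcal M\rtimes\mathcal A$ and $a\in\mathcal A$ put $t_x(a)=\hat E(ax)$. Then: 1. $x\mapsto t_x$ is an isomorphism of $C(\mathcal M)$-modules from $\mathcal M'\cap(\mathcal M\rtimes\mathcal A)$ onto $\mathcal T(\mathcal M)$. 2. $1\rtimes\mathcal A_R\subseteq\mathcal M'\cap(\mathcal M\rtimes\mathcal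 A)$, and $\{t_x : x\in 1\rtimes\mathcal A_R\}=\mathcal T^0(\mathcal M)$. 3. The action is outer if and only if $\mathcal M'\cap(\mathcal M\rtimes\mathcal A)=C(\mathcal M)\rtimes\mathcal A_R$. -/

import Mathlib

open scoped TensorProduct

noncomputable section

universe u v

/-- A weak C*-Hopf algebra structure on a unital C*-algebra `A`. Coassociativity and the counit
axioms are those of `Coalgebra ℂ A`; the finite dimensionality of `A` is a separate hypothesis
wherever the structure is used. In Sweedler notation, for all `x, y, z`:
`Δ(xy) = Δ(x)Δ(y)`, `Δ(x⋆) = Δ(x)⋆`, `(Δ(1) ⊗ 1)(1 ⊗ Δ(1)) = 1₍₁₎ ⊗ 1₍₂₎ ⊗ 1₍₃₎`,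
`ε(xyz) = ε(x y₍₁₎) ε(y₍₂₎ z)`,
`S(x₍₁₎)x₍₂₎ = 1₍₁₎ ε(x 1₍₂₎)`, `x₍₁₎S(x₍₂₎) = ε(1₍₁₎ x) 1₍₂₎`, `S(x₍₁₎)x₍₂₎S(x₍₃₎) = S(x)`. -/
class WeakCStarHopfAlgebra (A : Type u) [CStarAlgebra A] extends Coalgebra ℂ A where
  /-- the antipode `S` -/
  antipode : A →ₗ[ℂ] A
  comul_mul : ∀ x y : A, comul (x * y) = comul x * comul y
  comul_star : ∀ x : A, comul (star x) = star (comul x)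
  comul_one_mul : TensorProduct.assoc ℂ A A A (comul 1 ⊗ₜ[ℂ] (1 : A)) * ((1 : A) ⊗ₜ[ℂ] comul 1)
    = comul.lTensor A (comul 1)
  counit_mul_mul : ∀ x y z : A, counit (x * y * z) =
    LinearMap.mul' ℂ ℂ (TensorProduct.map (counit ∘ₗ LinearMap.mulLeft ℂ x)
      (counit ∘ₗ LinearMap.mulRight ℂ z) (comul y))
  antipode_mul : ∀ x : A, LinearMap.mul' ℂ A (antipode.rTensor A (comul x)) =
    TensorProduct.rid ℂ A ((counit ∘ₗ LinearMap.mulLeft ℂ x).lTensor A (comul 1))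
  mul_antipode : ∀ x : A, LinearMap.mul' ℂ A (antipode.lTensor A (comul x)) =
    TensorProduct.lid ℂ A ((counit ∘ₗ LinearMap.mulRight ℂ x).rTensor A (comul 1))
  antipode_mul_antipode : ∀ x : A,
    LinearMap.mul' ℂ A (TensorProduct.map antipode
      (LinearMap.mul' ℂ A ∘ₗ antipode.lTensor A ∘ₗ comul) (comul x)) = antipode x

namespace WeakHopf

open Coalgebra

section Algebra

variable (A : Type u) [CStarAlgebra A] [WeakCStarHopfAlgebra A]

/-- The antipode `S`. -/
abbrev S : A →ₗ[ℂ] A := WeakCStarHopfAlgebra.antipode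

/-- The map `a ↦ a₍₁₎ S(a₍₂₎)`. -/
def targetMap : A →ₗ[ℂ] A := LinearMap.mul' ℂ A ∘ₗ (S A).lTensor A ∘ₗ comul

/-- The map `a ↦ S(a₍₁₎) a₍₂₎`. -/
def sourceMap : A →ₗ[ℂ] A := LinearMap.mul' ℂ A ∘ₗ (S A).rTensor A ∘ₗ comul

/-- `A_L = {(φ ⊗ id)(Δ(1)) | φ ∈ Â}`. -/
def leftSub : Submodule ℂ A :=
  LinearMap.range ((TensorProduct.lid ℂ A).toLinearMap ∘ₗ
    (LinearMap.rTensorHom A : (A →ₗ[ℂ] ℂ) →ₗ[ℂ] _).flip (comul (1 : A)))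

/-- `A_R = {(id ⊗ φ)(Δ(1)) | φ ∈ Â}`. -/
def rightSub : Submodule ℂ A :=
  LinearMap.range ((TensorProduct.rid ℂ A).toLinearMap ∘ₗ
    (LinearMap.lTensorHom A : (A →ₗ[ℂ] ℂ) →ₗ[ℂ] _).flip (comul (1 : A)))

variable {A}

/-- `l` is a left integral: `a l = a₍₁₎ S(a₍₂₎) l` for all `a`. -/
def IsLeftIntegral (l : A) : Prop := ∀ a : A, a * l = targetMap A a * l

/-- `r` is a right integral: `r a = r S(a₍₁₎) a₍₂₎` for all `a`. -/
def IsRightIntegral (r : A) : Prop := ∀ a : A, r * a = r * sourceMap A a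

/-- `h` is a normalized Haar integral: a two sided integral with
`S(h₍₁₎) h₍₂₎ = h₍₁₎ S(h₍₂₎) = 1`. -/
def IsHaarIntegral (h : A) : Prop :=
  IsLeftIntegral h ∧ IsRightIntegral h ∧ sourceMap A h = 1 ∧ targetMap A h = 1

/-- The left action of the dual, `φ ⇀ a = a₍₁₎ φ(a₍₂₎)`. -/
def hit (φ : Module.Dual ℂ A) : A →ₗ[ℂ] A :=
  (TensorProduct.rid ℂ A).toLinearMap ∘ₗ φ.lTensor A ∘ₗ comul

/-- The convolution `(f * g)(a) = f(a₍₁₎) g(a₍₂₎)` on `Hom(A, M) = M ⊗ Â`, that is, the product of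
the algebra `M ⊗ Â`. For `M = ℂ` this is the product of the dual algebra `Â`. -/
def conv {M : Type v} [Ring M] [Algebra ℂ M] :
    (A →ₗ[ℂ] M) →ₗ[ℂ] (A →ₗ[ℂ] M) →ₗ[ℂ] (A →ₗ[ℂ] M) :=
  LinearMap.mk₂ ℂ (fun f g => LinearMap.mul' ℂ M ∘ₗ TensorProduct.map f g ∘ₗ comul)
    (fun f g h => by simp [TensorProduct.map_add_left, LinearMap.comp_add, LinearMap.add_comp])
    (fun c f g => by simp [TensorProduct.map_smul_left, LinearMap.comp_smul, LinearMap.smul_comp])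
    (fun f g h => by simp [TensorProduct.map_add_right, LinearMap.comp_add, LinearMap.add_comp])
    (fun c f g => by simp [TensorProduct.map_smul_right, LinearMap.comp_smul, LinearMap.smul_comp])

section Dual

variable [FiniteDimensional ℂ A]

/-- The coproduct of `Â`: `⟨Δ̂φ | x ⊗ y⟩ = ⟨φ | xy⟩`. -/
def dualComul (φ : Module.Dual ℂ A) : Module.Dual ℂ A ⊗[ℂ] Module.Dual ℂ A :=
  (TensorProduct.dualDistribEquiv ℂ A A).symm (φ ∘ₗ LinearMap.mul' ℂ A)

/-- The antipode of `Â`: `⟨Ŝφ | x⟩ = ⟨φ | S(x)⟩`. -/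
def dualAntipode : Module.Dual ℂ A →ₗ[ℂ] Module.Dual ℂ A := Module.Dual.transpose (S A)

/-- The element `φ₍₁₎ Ŝ(φ₍₂₎)` of `Â`. -/
def dualTargetMap (φ : Module.Dual ℂ A) : Module.Dual ℂ A :=
  TensorProduct.lift conv (dualAntipode.lTensor _ (dualComul φ))

/-- `lam ∈ Â` is a left integral of `Â`: `φ lam = φ₍₁₎ Ŝ(φ₍₂₎) lam` for all `φ ∈ Â`. -/
def IsDualLeftIntegral (lam : Module.Dual ℂ A) : Prop :=
  ∀ φ : Module.Dual ℂ A, conv φ lam = conv (dualTargetMap φ) lam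

/-- `lam ∈ Â` is the left integral dual to `l ∈ A`: `lam ⇀ l = 1`. -/
def IsIntegralDualTo (lam : Module.Dual ℂ A) (l : A) : Prop :=
  IsDualLeftIntegral lam ∧ hit lam l = 1

end Dual

/-! Elementary identities needed for the product of the crossed product. -/

lemma targetMap_eq (x : A) : targetMap A x =
    TensorProduct.lid ℂ A ((counit ∘ₗ LinearMap.mulRight ℂ x).rTensor A (comul (1 : A))) :=
  WeakCStarHopfAlgebra.mul_antipode x

lemma targetMap_mem (x : A) : targetMap A x ∈ leftSub A :=
  ⟨counit ∘ₗ LinearMap.mulRight ℂ x, (targetMap_eq x).symm⟩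

lemma mul_targetMap (x : A) :
    LinearMap.mul' ℂ A ((targetMap A).rTensor A (comul x)) = x := by
  have key : ∀ t u : A ⊗[ℂ] A,
      LinearMap.mul' ℂ A ((TensorProduct.lift
        (LinearMap.mk₂ ℂ (fun p q : A => TensorProduct.lid ℂ A
          ((counit ∘ₗ LinearMap.mulRight ℂ p).rTensor A t) ⊗ₜ[ℂ] q)
          (by
            intro p p' q
            rw [← TensorProduct.add_tmul, ← map_add, ← LinearMap.add_apply,
              ← LinearMap.rTensor_add, ← LinearMap.comp_add]
            congr 5
            ext; simp [mul_add])
          (by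
            intro c p q
            rw [TensorProduct.smul_tmul', ← map_smul, ← LinearMap.smul_apply,
              ← LinearMap.rTensor_smul, ← LinearMap.comp_smul]
            congr 5
            ext; simp)
          (fun p q q' => TensorProduct.tmul_add _ _ _)
          (fun c p q => TensorProduct.tmul_smul _ _ _))) u) =
      TensorProduct.lid ℂ A ((counit (R := ℂ) (A := A)).rTensor A (t * u)) := by
    intro t u
    induction u with
    | zero => simp
    | add u u' hu hu' => rw [map_add, map_add, hu, hu', mul_add, map_add, map_add]
    | tmul p q =>
      induction t with
      | zero => simp
      | add t t' ht ht' =>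
        simp only [TensorProduct.lift.tmul, LinearMap.mk₂_apply, LinearMap.mul'_apply] at ht ht' ⊢
        rw [map_add, map_add, add_mul, ht, ht', add_mul, map_add, map_add]
      | tmul a b => simp
  have h2 := key (comul 1) (comul x)
  rw [← WeakCStarHopfAlgebra.comul_mul, one_mul, Coalgebra.rTensor_counit_comul,
    TensorProduct.lid_tmul, one_smul] at h2
  refine Eq.trans ?_ h2
  congr 1
  refine LinearMap.congr_fun ?_ (comul x)
  ext p q
  simp [targetMap_eq]

lemma comul_of_mem {b : A} (hb : b ∈ leftSub A) :
    comul b = (b ⊗ₜ[ℂ] (1 : A)) * comul (1 : A) := by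
  obtain ⟨φ, rfl⟩ := hb
  have key : ∀ t : A ⊗[ℂ] A, ∀ u : A ⊗[ℂ] A,
      TensorProduct.lid ℂ (A ⊗[ℂ] A) (φ.rTensor (A ⊗[ℂ] A)
        (TensorProduct.assoc ℂ A A A (t ⊗ₜ[ℂ] (1 : A)) * ((1 : A) ⊗ₜ[ℂ] u))) =
      (TensorProduct.lid ℂ A (φ.rTensor A t) ⊗ₜ[ℂ] (1 : A)) * u := by
    intro t u
    induction t with
    | zero => simp
    | add t t' ht ht' =>
      rw [TensorProduct.add_tmul, map_add, add_mul, map_add, map_add, ht, ht', map_add, map_add,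
        TensorProduct.add_tmul, add_mul]
    | tmul a b =>
      induction u with
      | zero => simp
      | add u u' hu hu' =>
        rw [TensorProduct.tmul_add, mul_add, map_add, map_add, hu, hu', mul_add]
      | tmul c d => simp [TensorProduct.smul_tmul']
  have key2 : ∀ t : A ⊗[ℂ] A,
      TensorProduct.lid ℂ (A ⊗[ℂ] A) (φ.rTensor (A ⊗[ℂ] A)
        ((comul (R := ℂ) (A := A)).lTensor A t)) =
      comul (TensorProduct.lid ℂ A (φ.rTensor A t)) := by
    intro t
    induction t with
    | zero => simp
    | add t t' ht ht' => simp only [map_add, ht, ht']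
    | tmul a b => simp
  have h := key (comul 1) (comul 1)
  rw [WeakCStarHopfAlgebra.comul_one_mul, key2] at h
  exact h

lemma star_comul_one : star (comul (R := ℂ) (1 : A)) = comul (1 : A) := by
  rw [← WeakCStarHopfAlgebra.comul_star, star_one]

lemma star_mem_leftSub {b : A} (hb : b ∈ leftSub A) : star b ∈ leftSub A := by
  obtain ⟨φ, rfl⟩ := hb
  let ψ : A →ₗ[ℂ] ℂ :=
    { toFun := fun a => star (φ (star a))
      map_add' := fun a b => by simp
      map_smul' := fun c a => by simp }
  refine ⟨ψ, ?_⟩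
  have key : ∀ t : A ⊗[ℂ] A, TensorProduct.lid ℂ A (ψ.rTensor A (star t)) =
      star (TensorProduct.lid ℂ A (φ.rTensor A t)) := by
    intro t
    induction t with
    | zero => simp
    | add t t' ht ht' => simp only [map_add, star_add, ht, ht']
    | tmul a b => simp [ψ]
  have h := key (comul 1)
  rw [star_comul_one] at h
  exact h

lemma comul_of_mem' {b : A} (hb : b ∈ leftSub A) :
    comul b = comul (1 : A) * (b ⊗ₜ[ℂ] (1 : A)) := by
  have h := congrArg star (comul_of_mem (star_mem_leftSub hb))
  rw [star_mul, star_comul_one, ← WeakCStarHopfAlgebra.comul_star, star_star] at h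
  simpa using h

lemma comul_mul_of_mem {b : A} (hb : b ∈ leftSub A) (x : A) :
    comul (b * x) = (b ⊗ₜ[ℂ] (1 : A)) * comul x := by
  rw [WeakCStarHopfAlgebra.comul_mul, comul_of_mem hb, mul_assoc,
    ← WeakCStarHopfAlgebra.comul_mul, one_mul]

lemma comul_mul_of_mem' {b : A} (hb : b ∈ leftSub A) (x : A) :
    comul (x * b) = comul x * (b ⊗ₜ[ℂ] (1 : A)) := by
  rw [WeakCStarHopfAlgebra.comul_mul, comul_of_mem' hb, ← mul_assoc,
    ← WeakCStarHopfAlgebra.comul_mul, mul_one]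

/-- `Δ(1) ∈ A ⊗ A_L`. -/
lemma comul_one_mem [FiniteDimensional ℂ A] :
    ∃ (n : ℕ) (e f : Fin n → A), (∀ i, f i ∈ leftSub A) ∧
      comul (1 : A) = ∑ i, e i ⊗ₜ[ℂ] f i := by
  let B := Module.finBasis ℂ A
  refine ⟨_, B, fun i => TensorProduct.lid ℂ A ((B.coord i).rTensor A (comul (1 : A))),
    fun i => ⟨B.coord i, rfl⟩, ?_⟩
  have key : ∀ t : A ⊗[ℂ] A,
      t = ∑ i, B i ⊗ₜ[ℂ] TensorProduct.lid ℂ A ((B.coord i).rTensor A t) := by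
    intro t
    induction t with
    | zero => simp
    | add t t' ht ht' =>
      simp only [map_add, TensorProduct.tmul_add, Finset.sum_add_distrib]
      rw [← ht, ← ht']
    | tmul a b =>
      simp only [LinearMap.rTensor_tmul, TensorProduct.lid_tmul, TensorProduct.tmul_smul,
        TensorProduct.smul_tmul', ← TensorProduct.sum_tmul]
      congr 1
      simp
  exact key _

end Algebra

/-- An `A`-module algebra structure `▷ : A ⊗ M → M` on a unital *-algebra `M`:
`(ab) ▷ m = a ▷ (b ▷ m)`, `1 ▷ m = m`, `a ▷ (mn) = (a₍₁₎ ▷ m)(a₍₂₎ ▷ n)`,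
`(a ▷ m)⋆ = S(a)⋆ ▷ m⋆` and `a ▷ 1 = (a₍₁₎ S(a₍₂₎)) ▷ 1`. -/
structure ModuleAlgebra (A : Type u) [CStarAlgebra A] [WeakCStarHopfAlgebra A]
    (M : Type v) [Ring M] [StarRing M] [Algebra ℂ M] where
  /-- the action, `act a m = a ▷ m` -/
  act : A →ₗ[ℂ] M →ₗ[ℂ] M
  mul_act : ∀ (a b : A) (m : M), act (a * b) m = act a (act b m)
  one_act : ∀ m : M, act 1 m = m
  act_mul : ∀ (a : A) (m n : M), act a (m * n) =
    LinearMap.mul' ℂ M (TensorProduct.map (act.flip m) (act.flip n) (comul a))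
  star_act : ∀ (a : A) (m : M), star (act a m) = act (star (S A a)) (star m)
  act_one : ∀ a : A, act a 1 = act (targetMap A a) 1

namespace ModuleAlgebra

variable {A : Type u} [CStarAlgebra A] [WeakCStarHopfAlgebra A]
  {M : Type v} [Ring M] [StarRing M] [Algebra ℂ M] (α : ModuleAlgebra A M)

/-- The subspace of `M ⊗ A` spanned by all `m (b ▷ 1) ⊗ a - m ⊗ b a` with `b ∈ A_L`. (The spanning
set is stable under left multiplication by `M`, so its span over `M` and its span over `ℂ` agree.) -/
def rel : Submodule M (M ⊗[ℂ] A) :=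
  Submodule.span M {x | ∃ (m : M) (b a : A), b ∈ leftSub A ∧
    x = (m * α.act b 1) ⊗ₜ[ℂ] a - m ⊗ₜ[ℂ] (b * a)}

/-- The crossed product `M ⋊ A = M ⊗_{A_L} A`. -/
def CrossedProduct : Type (max u v) := (M ⊗[ℂ] A) ⧸ α.rel

instance : AddCommGroup α.CrossedProduct := inferInstanceAs (AddCommGroup ((M ⊗[ℂ] A) ⧸ α.rel))

instance : Module M α.CrossedProduct := inferInstanceAs (Module M ((M ⊗[ℂ] A) ⧸ α.rel))

instance : Module ℂ α.CrossedProduct := inferInstanceAs (Module ℂ ((M ⊗[ℂ] A) ⧸ α.rel))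

/-- The quotient map `M ⊗ A → M ⋊ A`. -/
def proj : (M ⊗[ℂ] A) →ₗ[M] α.CrossedProduct := α.rel.mkQ

/-- The quotient map `M ⊗ A → M ⋊ A`, as a `ℂ`-linear map. -/
def projC : (M ⊗[ℂ] A) →ₗ[ℂ] α.CrossedProduct where
  toFun := α.proj
  map_add' := map_add _
  map_smul' := fun _ _ => rfl

@[simp] lemma projC_apply (x : M ⊗[ℂ] A) : α.projC x = α.proj x := rfl

lemma proj_surjective : Function.Surjective α.proj := α.rel.mkQ_surjective

lemma proj_eq_zero {x : M ⊗[ℂ] A} : α.proj x = 0 ↔ x ∈ α.rel :=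
  Submodule.Quotient.mk_eq_zero _

/-- `α.cros m a` is the element `m ⋊ a` of `M ⋊ A`. -/
def cros (m : M) (a : A) : α.CrossedProduct := α.proj (m ⊗ₜ[ℂ] a)

lemma proj_rel {b : A} (hb : b ∈ leftSub A) (m : M) (a : A) :
    α.proj ((m * α.act b 1) ⊗ₜ[ℂ] a) = α.proj (m ⊗ₜ[ℂ] (b * a)) := by
  rw [← sub_eq_zero, ← map_sub, proj_eq_zero]
  exact Submodule.subset_span ⟨m, b, a, hb, rfl⟩

/-- `α.twist a m = (a₍₁₎ ▷ m) ⊗ a₍₂₎`. -/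
def twist : A →ₗ[ℂ] M →ₗ[ℂ] M ⊗[ℂ] A :=
  LinearMap.mk₂ ℂ (fun a m => (α.act.flip m).rTensor A (comul a))
    (fun a b m => by simp)
    (fun c a m => by simp)
    (fun a m n => by simp [LinearMap.rTensor_add])
    (fun c a m => by simp [LinearMap.rTensor_smul])

lemma twist_apply (a : A) (m : M) : α.twist a m = (α.act.flip m).rTensor A (comul a) := rfl

/-- `α.lact a (n ⊗ b) = (a₍₁₎ ▷ n) ⊗ a₍₂₎ b`. -/
def lact : A →ₗ[ℂ] (M ⊗[ℂ] A) →ₗ[ℂ] M ⊗[ℂ] A where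
  toFun a := TensorProduct.lift (LinearMap.mk₂ ℂ
    (fun (n : M) (b : A) => α.twist a n * ((1 : M) ⊗ₜ[ℂ] b))
    (fun n n' b => by simp [add_mul])
    (fun c n b => by simp)
    (fun n b b' => by simp [TensorProduct.tmul_add, mul_add])
    (fun c n b => by simp))
  map_add' a a' := by ext; simp [add_mul]
  map_smul' c a := by ext; simp

@[simp] lemma lact_tmul (a : A) (n : M) (b : A) :
    α.lact a (n ⊗ₜ[ℂ] b) = α.twist a n * ((1 : M) ⊗ₜ[ℂ] b) := rfl

/-- The bilinear map `(m ⊗ a, n ⊗ b) ↦ m (a₍₁₎ ▷ n) ⊗ a₍₂₎ b` on `M ⊗ A`. -/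
def mulMap : (M ⊗[ℂ] A) →ₗ[ℂ] (M ⊗[ℂ] A) →ₗ[ℂ] M ⊗[ℂ] A :=
  TensorProduct.lift (LinearMap.mk₂ ℂ
    (fun (m : M) (a : A) => LinearMap.mulLeft ℂ (m ⊗ₜ[ℂ] (1 : A)) ∘ₗ α.lact a)
    (fun m m' a => by ext; simp [TensorProduct.add_tmul, add_mul])
    (fun c m a => by ext; simp [← TensorProduct.smul_tmul'])
    (fun m a a' => by ext; simp [mul_add])
    (fun c m a => by ext; simp))

@[simp] lemma mulMap_tmul (m : M) (a : A) (x : M ⊗[ℂ] A) :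
    α.mulMap (m ⊗ₜ[ℂ] a) x = (m ⊗ₜ[ℂ] (1 : A)) * α.lact a x := rfl

lemma lact_mul_right (a : A) (x : M ⊗[ℂ] A) (b : A) :
    α.lact a (x * ((1 : M) ⊗ₜ[ℂ] b)) = α.lact a x * ((1 : M) ⊗ₜ[ℂ] b) := by
  induction x with
  | zero => simp
  | add x y hx hy => simp only [add_mul, map_add, hx, hy]
  | tmul n c => simp [mul_assoc]

lemma twist_mul (a b : A) (m : M) : α.twist (a * b) m = α.lact a (α.twist b m) := by
  rw [twist_apply, twist_apply, WeakCStarHopfAlgebra.comul_mul]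
  induction comul (R := ℂ) b with
  | zero => simp
  | add x y hx hy => rw [mul_add, map_add, map_add, map_add, hx, hy]
  | tmul p q =>
    simp only [LinearMap.rTensor_tmul, lact_tmul, twist_apply]
    induction comul (R := ℂ) a with
    | zero => simp
    | add x y hx hy => rw [add_mul, map_add, map_add, add_mul, hx, hy]
    | tmul r s => simp [α.mul_act]

lemma lact_mul (a b : A) (x : M ⊗[ℂ] A) : α.lact (a * b) x = α.lact a (α.lact b x) := by
  induction x with
  | zero => simp
  | add x y hx hy => simp only [map_add, hx, hy]
  | tmul n c => rw [lact_tmul, lact_tmul, lact_mul_right, twist_mul]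

lemma twist_mul_right (a : A) (m n : M) : α.twist a (m * n) = α.mulMap (α.twist a m) (n ⊗ₜ[ℂ] 1) := by
  have h := congrArg (fun t => (LinearMap.rTensor A (LinearMap.mul' ℂ M ∘ₗ
    TensorProduct.map (α.act.flip m) (α.act.flip n))) ((TensorProduct.assoc ℂ A A A).symm t))
    (Coalgebra.coassoc_apply (R := ℂ) a)
  simp only [LinearEquiv.symm_apply_apply] at h
  rw [twist_apply, twist_apply]
  have h1 : α.act.flip (m * n) = (LinearMap.mul' ℂ M ∘ₗ
      TensorProduct.map (α.act.flip m) (α.act.flip n)) ∘ₗ comul := by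
    ext b
    simp [α.act_mul]
  rw [h1, LinearMap.rTensor_comp, LinearMap.comp_apply, h]
  induction comul (R := ℂ) a with
  | zero => simp
  | add x y hx hy => simp only [map_add, hx, hy, LinearMap.add_apply]
  | tmul p q =>
    simp only [LinearMap.lTensor_tmul, LinearMap.rTensor_tmul, mulMap_tmul, lact_tmul, twist_apply]
    induction comul (R := ℂ) q with
    | zero => simp
    | add x y hx hy => simp only [TensorProduct.tmul_add, map_add, hx, hy, add_mul, mul_add]
    | tmul r s => simp

lemma mulMap_mul_right (x y : M ⊗[ℂ] A) (b : A) :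
    α.mulMap x (y * ((1 : M) ⊗ₜ[ℂ] b)) = α.mulMap x y * ((1 : M) ⊗ₜ[ℂ] b) := by
  induction x with
  | zero => simp
  | add x x' hx hx' => simp only [map_add, LinearMap.add_apply, hx, hx', add_mul]
  | tmul m a => rw [mulMap_tmul, mulMap_tmul, lact_mul_right, mul_assoc]

lemma lact_mul_left (a : A) (m : M) (x : M ⊗[ℂ] A) :
    α.lact a ((m ⊗ₜ[ℂ] (1 : A)) * x) = α.mulMap (α.twist a m) x := by
  induction x with
  | zero => simp
  | add x y hx hy => simp only [mul_add, map_add, hx, hy]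
  | tmul n c =>
    have h : (n ⊗ₜ[ℂ] c : M ⊗[ℂ] A) = (n ⊗ₜ[ℂ] (1 : A)) * ((1 : M) ⊗ₜ[ℂ] c) := by simp
    rw [h, mulMap_mul_right, ← mul_assoc, lact_mul_right, ← twist_mul_right]
    simp [← Algebra.TensorProduct.one_def]

lemma mulMap_mul_left (m : M) (x y : M ⊗[ℂ] A) :
    α.mulMap ((m ⊗ₜ[ℂ] (1 : A)) * x) y = (m ⊗ₜ[ℂ] (1 : A)) * α.mulMap x y := by
  induction x with
  | zero => simp
  | add x x' hx hx' => simp only [map_add, LinearMap.add_apply, hx, hx', mul_add]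
  | tmul n a => simp [← mul_assoc]

lemma mulMap_mul_one_tmul (x : M ⊗[ℂ] A) (b : A) (y : M ⊗[ℂ] A) :
    α.mulMap (x * ((1 : M) ⊗ₜ[ℂ] b)) y = α.mulMap x (α.lact b y) := by
  induction x with
  | zero => simp
  | add x x' hx hx' => simp only [map_add, LinearMap.add_apply, hx, hx', add_mul]
  | tmul n a => simp [lact_mul]

lemma mulMap_assoc (x y z : M ⊗[ℂ] A) :
    α.mulMap (α.mulMap x y) z = α.mulMap x (α.mulMap y z) := by
  induction x with
  | zero => simp
  | add x x' hx hx' => simp only [map_add, LinearMap.add_apply, hx, hx']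
  | tmul m a =>
    induction y with
    | zero => simp
    | add y y' hy hy' => simp only [map_add, LinearMap.add_apply, hy, hy']
    | tmul n b =>
      rw [mulMap_tmul, mulMap_mul_left, lact_tmul, mulMap_mul_one_tmul, mulMap_tmul, mulMap_tmul,
        lact_mul_left]

lemma smul_eq_mul_tensor (m : M) (x : M ⊗[ℂ] A) : m • x = (m ⊗ₜ[ℂ] (1 : A)) * x := by
  induction x with
  | zero => simp
  | add x y hx hy => rw [smul_add, hx, hy, mul_add]
  | tmul n a => simp [TensorProduct.smul_tmul']

lemma act_of_mem {b : A} (hb : b ∈ leftSub A) (m : M) : α.act b m = α.act b 1 * m := by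
  have h1 := α.act_mul b 1 m
  rw [one_mul, comul_of_mem' hb] at h1
  have h2 := α.act_mul 1 (α.act b 1) m
  rw [α.one_act] at h2
  rw [h1, h2]
  induction comul (R := ℂ) (1 : A) with
  | zero => simp
  | add x y hx hy => simp only [add_mul, map_add, hx, hy]
  | tmul p q => simp [α.mul_act]

lemma lact_of_mem {b : A} (hb : b ∈ leftSub A) (x : M ⊗[ℂ] A) :
    α.lact b x = (α.act b 1 ⊗ₜ[ℂ] (1 : A)) * α.lact 1 x := by
  induction x with
  | zero => simp
  | add x y hx hy => simp only [map_add, hx, hy, mul_add]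
  | tmul n a =>
    rw [lact_tmul, lact_tmul, ← mul_assoc]
    congr 1
    rw [twist_apply, twist_apply, comul_of_mem hb]
    induction comul (R := ℂ) (1 : A) with
    | zero => simp
    | add x y hx hy => simp only [map_add, hx, hy, mul_add]
    | tmul p q => simp [α.mul_act, α.act_of_mem hb (α.act p n)]

lemma mulMap_rel_left {x : M ⊗[ℂ] A} (hx : x ∈ α.rel) (y : M ⊗[ℂ] A) : α.mulMap x y = 0 := by
  induction hx using Submodule.span_induction with
  | mem x h =>
    obtain ⟨m, b, a, hb, rfl⟩ := h
    rw [map_sub, LinearMap.sub_apply, mulMap_tmul, mulMap_tmul, lact_mul, lact_of_mem α hb,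
      ← lact_mul, one_mul, ← mul_assoc]
    simp
  | zero => simp
  | add x x' _ _ hx hx' => rw [map_add, LinearMap.add_apply, hx, hx', add_zero]
  | smul m x _ hx => rw [smul_eq_mul_tensor, mulMap_mul_left, hx, mul_zero]

lemma proj_twist_one (x a : A) :
    α.proj (α.twist x 1 * ((1 : M) ⊗ₜ[ℂ] a)) = α.proj ((1 : M) ⊗ₜ[ℂ] (x * a)) := by
  have h : ∀ t : A ⊗[ℂ] A, α.proj ((α.act.flip 1).rTensor A t * ((1 : M) ⊗ₜ[ℂ] a)) =
      α.proj ((1 : M) ⊗ₜ[ℂ] (LinearMap.mul' ℂ A ((targetMap A).rTensor A t) * a)) := by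
    intro t
    induction t with
    | zero => simp
    | add t t' ht ht' => simp only [map_add, add_mul, TensorProduct.tmul_add, ht, ht']
    | tmul p q =>
      have := α.proj_rel (targetMap_mem p) 1 (q * a)
      rw [one_mul, ← α.act_one] at this
      simpa [mul_assoc] using this
  have h1 := h (comul x)
  rwa [mul_targetMap] at h1

lemma lact_rel_gen (q : A) {b : A} (hb : b ∈ leftSub A) (a : A) :
    α.proj (α.lact q (α.act b 1 ⊗ₜ[ℂ] a)) = α.proj (α.lact q ((1 : M) ⊗ₜ[ℂ] (b * a))) := by
  have h : α.twist q (α.act b 1) = α.twist (q * b) 1 := by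
    rw [twist_apply, twist_apply, comul_mul_of_mem' hb]
    induction comul (R := ℂ) q with
    | zero => simp
    | add x y hx hy => simp only [map_add, add_mul, hx, hy]
    | tmul p q => simp [α.mul_act]
  rw [lact_tmul, lact_tmul, h, proj_twist_one, proj_twist_one, mul_assoc]

lemma mulMap_rel_right (x : M ⊗[ℂ] A) {y : M ⊗[ℂ] A} (hy : y ∈ α.rel) :
    α.mulMap x y ∈ α.rel := by
  induction hy using Submodule.span_induction generalizing x with
  | mem y h =>
    obtain ⟨m, b, a, hb, rfl⟩ := h
    have h1 : (m * α.act b 1) ⊗ₜ[ℂ] a - m ⊗ₜ[ℂ] (b * a) =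
        (m ⊗ₜ[ℂ] (1 : A)) * (α.act b 1 ⊗ₜ[ℂ] a - (1 : M) ⊗ₜ[ℂ] (b * a)) := by
      simp [mul_sub]
    have h2 : ∀ z : M ⊗[ℂ] A,
        α.mulMap z (α.act b 1 ⊗ₜ[ℂ] a - (1 : M) ⊗ₜ[ℂ] (b * a)) ∈ α.rel := by
      intro z
      induction z with
      | zero => simp
      | add z z' hz hz' => rw [map_add]; exact add_mem hz hz'
      | tmul n c =>
        rw [mulMap_tmul, ← smul_eq_mul_tensor]
        refine Submodule.smul_mem _ _ ?_
        rw [← proj_eq_zero, map_sub, map_sub, α.lact_rel_gen c hb, sub_self]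
    rw [h1]
    induction x with
    | zero => simp
    | add x x' hx hx' => rw [map_add]; exact add_mem hx hx'
    | tmul n c =>
      rw [mulMap_tmul, ← smul_eq_mul_tensor, lact_mul_left]
      exact Submodule.smul_mem _ _ (h2 _)
  | zero => simp
  | add y y' _ _ hy hy' => rw [map_add]; exact add_mem (hy x) (hy' x)
  | smul m y _ hy =>
    have : ∀ z : M ⊗[ℂ] A, α.mulMap z (m • y) ∈ α.rel := by
      intro z
      induction z with
      | zero => simp
      | add z z' hz hz' => rw [map_add]; exact add_mem hz hz'
      | tmul n c =>
        rw [mulMap_tmul, ← smul_eq_mul_tensor, smul_eq_mul_tensor m y, lact_mul_left]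
        exact Submodule.smul_mem _ _ (hy _)
    exact this x

/-- The product `(m ⋊ a)(n ⋊ b) = m (a₍₁₎ ▷ n) ⋊ a₍₂₎ b` of the crossed product. -/
def crosMul : α.CrossedProduct →+ α.CrossedProduct →+ α.CrossedProduct :=
  QuotientAddGroup.lift α.rel.toAddSubgroup
    { toFun := fun x => QuotientAddGroup.lift α.rel.toAddSubgroup
        (α.proj.toAddMonoidHom.comp (α.mulMap x).toAddMonoidHom)
        (fun y hy => (α.proj_eq_zero).2 (α.mulMap_rel_right x hy))
      map_zero' := by
        refine AddMonoidHom.ext fun y => ?_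
        induction y using QuotientAddGroup.induction_on with
        | H y =>
          change α.proj (α.mulMap 0 y) = 0
          simp
      map_add' := fun x x' => by
        refine AddMonoidHom.ext fun y => ?_
        induction y using QuotientAddGroup.induction_on with
        | H y =>
          change α.proj (α.mulMap (x + x') y) = α.proj (α.mulMap x y) + α.proj (α.mulMap x' y)
          simp }
    (fun x hx => by
      refine AddMonoidHom.ext fun y => ?_
      induction y using QuotientAddGroup.induction_on with
      | H y =>
        change α.proj (α.mulMap x y) = 0
        rw [α.mulMap_rel_left hx, map_zero])

instance : Mul α.CrossedProduct := ⟨fun x y => α.crosMul x y⟩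

instance : One α.CrossedProduct := ⟨α.cros 1 1⟩

lemma proj_mul (x y : M ⊗[ℂ] A) : α.proj x * α.proj y = α.proj (α.mulMap x y) := rfl

lemma mul_add_aux (x y z : α.CrossedProduct) : x * (y + z) = x * y + x * z :=
  map_add (α.crosMul x) y z

lemma add_mul_aux (x y z : α.CrossedProduct) : (x + y) * z = x * z + y * z := by
  change α.crosMul (x + y) z = α.crosMul x z + α.crosMul y z
  rw [map_add, AddMonoidHom.add_apply]

lemma mul_one_aux (x : M ⊗[ℂ] A) : α.proj x * 1 = α.proj x := by
  induction x with
  | zero => rw [map_zero]; exact DFunLike.congr_fun (map_zero α.crosMul) _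
  | add x y hx hy => rw [map_add, add_mul_aux, hx, hy]
  | tmul m a =>
    change α.proj (m ⊗ₜ[ℂ] a) * α.proj ((1 : M) ⊗ₜ[ℂ] (1 : A)) = _
    rw [proj_mul, mulMap_tmul, lact_tmul, ← smul_eq_mul_tensor, map_smul, proj_twist_one, mul_one,
      ← map_smul, smul_eq_mul_tensor]
    simp

lemma one_mul_aux [FiniteDimensional ℂ A] (x : M ⊗[ℂ] A) : 1 * α.proj x = α.proj x := by
  induction x with
  | zero => rw [map_zero]; exact map_zero (α.crosMul _)
  | add x y hx hy => rw [map_add, mul_add_aux, hx, hy]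
  | tmul m a =>
    change α.proj ((1 : M) ⊗ₜ[ℂ] (1 : A)) * α.proj (m ⊗ₜ[ℂ] a) = _
    obtain ⟨n, e, f, hf, h1⟩ := comul_one_mem (A := A)
    have h2 := α.act_mul 1 m 1
    rw [mul_one, α.one_act, h1] at h2
    rw [proj_mul, mulMap_tmul, lact_tmul, ← Algebra.TensorProduct.one_def, one_mul, twist_apply, h1]
    simp only [map_sum, LinearMap.rTensor_tmul, Finset.sum_mul,
      Algebra.TensorProduct.tmul_mul_tmul, mul_one]
    simp only [← α.proj_rel (hf _)]
    rw [← map_sum, ← TensorProduct.sum_tmul]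
    congr 2
    refine Eq.trans ?_ h2.symm
    simp

instance [FiniteDimensional ℂ A] : Ring α.CrossedProduct where
  __ := (inferInstance : AddCommGroup α.CrossedProduct)
  __ := (inferInstance : Mul α.CrossedProduct)
  __ := (inferInstance : One α.CrossedProduct)
  mul_assoc x y z := by
    obtain ⟨x, rfl⟩ := α.proj_surjective x
    obtain ⟨y, rfl⟩ := α.proj_surjective y
    obtain ⟨z, rfl⟩ := α.proj_surjective z
    simp only [proj_mul, mulMap_assoc]
  left_distrib := α.mul_add_aux
  right_distrib := α.add_mul_aux
  zero_mul x := DFunLike.congr_fun (map_zero α.crosMul) x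
  mul_zero x := map_zero (α.crosMul x)
  one_mul x := by
    obtain ⟨x, rfl⟩ := α.proj_surjective x
    exact α.one_mul_aux x
  mul_one x := by
    obtain ⟨x, rfl⟩ := α.proj_surjective x
    exact α.mul_one_aux x

lemma smul_def [FiniteDimensional ℂ A] (m : M) (x : α.CrossedProduct) :
    m • x = α.cros m 1 * x := by
  obtain ⟨x, rfl⟩ := α.proj_surjective x
  change m • α.proj x = α.proj (m ⊗ₜ[ℂ] 1) * α.proj x
  rw [proj_mul, mulMap_tmul, ← smul_eq_mul_tensor, map_smul]
  congr 1
  rw [← one_mul (α.proj x)]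
  change α.proj ((1 : M) ⊗ₜ[ℂ] (1 : A)) * α.proj x = _
  rw [proj_mul, mulMap_tmul, ← Algebra.TensorProduct.one_def, one_mul]

lemma smul_mul_cros (c : ℂ) (x y : α.CrossedProduct) : (c • x) * y = c • (x * y) := by
  obtain ⟨x, rfl⟩ := α.proj_surjective x
  obtain ⟨y, rfl⟩ := α.proj_surjective y
  change α.projC (α.mulMap (c • x) y) = c • α.projC (α.mulMap x y)
  simp

/-- The product of two elements of the crossed product, on generators. -/
lemma cros_mul_cros (m n : M) (a b : A) : α.cros m a * α.cros n b =
    α.proj ((m ⊗ₜ[ℂ] (1 : A)) * (α.act.flip n).rTensor A (comul a) * ((1 : M) ⊗ₜ[ℂ] b)) := by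
  change α.proj (m ⊗ₜ[ℂ] a) * α.proj (n ⊗ₜ[ℂ] b) = _
  rw [proj_mul, mulMap_tmul, lact_tmul, mul_assoc, twist_apply]

/-- The relative commutant `M' ∩ (M ⋊ A)`, as a module over the center `C(M)`; here `M` is
identified with `M ⋊ 1`. -/
def relCommutant [FiniteDimensional ℂ A] :
    Submodule (Subalgebra.center ℂ M) α.CrossedProduct where
  carrier := {x | ∀ m : M, α.cros m 1 * x = x * α.cros m 1}
  zero_mem' m := by simp
  add_mem' hx hy m := by rw [mul_add, add_mul, hx m, hy m]
  smul_mem' z x hx m := by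
    have h : ∀ y : α.CrossedProduct, z • y = α.cros (z : M) 1 * y := fun y => α.smul_def (z : M) y
    have hz : α.cros m 1 * α.cros (z : M) 1 = α.cros (z : M) 1 * α.cros m 1 := by
      rw [← smul_def, ← smul_def]
      change m • α.proj _ = (z : M) • α.proj _
      rw [← map_smul, ← map_smul, TensorProduct.smul_tmul', TensorProduct.smul_tmul', smul_eq_mul,
        smul_eq_mul, Subalgebra.mem_center_iff.1 z.2 m]
    rw [h, ← mul_assoc, hz, mul_assoc, hx m, mul_assoc]

/-- The coaction `ρ̂ : M → M ⊗ Â = Hom(A, M)` dual to the action, `ρ̂(m)(a) = a ▷ m`. -/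
def coaction (m : M) : A →ₗ[ℂ] M := α.act.flip m

/-- The space of inner implementers `T ∈ M ⊗ Â = Hom(A, M)`, that is, `T (m ⊗ 1̂) = ρ̂(m) T` for all
`m ∈ M`, as a module over the center `C(M)` through `(z T)(a) = z T(a)`. -/
def implementers : Submodule (Subalgebra.center ℂ M) (A →ₗ[ℂ] M) where
  carrier := {T | ∀ m : M,
    conv T ((counit (R := ℂ) (A := A)).smulRight m) = conv (α.coaction m) T}
  zero_mem' m := by simp
  add_mem' hx hy m := by rw [map_add, LinearMap.add_apply, map_add, hx m, hy m]
  smul_mem' z T hT m := by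
    have h1 : ∀ f : A →ₗ[ℂ] M, conv (z • T) f = z • conv T f := by
      intro f
      ext a
      change LinearMap.mul' ℂ M (TensorProduct.map (z • T) f (comul a)) =
        (z : M) * LinearMap.mul' ℂ M (TensorProduct.map T f (comul a))
      induction comul (R := ℂ) a with
      | zero => simp
      | add x y hx hy => simp only [map_add, mul_add, hx, hy]
      | tmul p q =>
        simp only [TensorProduct.map_tmul, LinearMap.mul'_apply, ← mul_assoc]
        rfl
    have h2 : ∀ f : A →ₗ[ℂ] M, conv f (z • T) = z • conv f T := by
      intro f
      ext a
      change LinearMap.mul' ℂ M (TensorProduct.map f (z • T) (comul a)) =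
        (z : M) * LinearMap.mul' ℂ M (TensorProduct.map f T (comul a))
      induction comul (R := ℂ) a with
      | zero => simp
      | add x y hx hy => simp only [map_add, mul_add, hx, hy]
      | tmul p q =>
        simp only [TensorProduct.map_tmul, LinearMap.mul'_apply, ← mul_assoc]
        rw [← Subalgebra.mem_center_iff.1 z.2 (f p), mul_assoc]
        rfl
    rw [h1, h2, hT m]

/-- The trivial inner implementers `ρ̂(1) (1 ⊗ lam)`, where `lam` is a left integral of `Â`. -/
def trivialImplementers [FiniteDimensional ℂ A] : Set (A →ₗ[ℂ] M) :=
  {T | ∃ lam : Module.Dual ℂ A, IsDualLeftIntegral lam ∧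
    T = conv (α.coaction 1) (lam.smulRight (1 : M))}

/-- The action is outer if every inner implementer lies in the `C(M)`-span of the trivial ones. -/
def IsOuter [FiniteDimensional ℂ A] : Prop :=
  α.implementers = Submodule.span (Subalgebra.center ℂ M) α.trivialImplementers

/-- The set `1 ⋊ A_R`. -/
def oneCrosRight : Set α.CrossedProduct := {x | ∃ b ∈ rightSub A, x = α.cros 1 b}

/-- The subspace `C(M) ⋊ A_R`, spanned by all `z ⋊ b` with `z ∈ C(M)` and `b ∈ A_R`. -/
def centerCrosRight : Submodule (Subalgebra.center ℂ M) α.CrossedProduct :=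
  Submodule.span (Subalgebra.center ℂ M)
    {x | ∃ z ∈ Subalgebra.center ℂ M, ∃ b ∈ rightSub A, x = α.cros z b}

lemma hit_mul {b : A} (hb : b ∈ leftSub A) (φ : Module.Dual ℂ A) (a : A) :
    hit φ (b * a) = b * hit φ a := by
  change TensorProduct.rid ℂ A (φ.lTensor A (comul (b * a))) =
    b * TensorProduct.rid ℂ A (φ.lTensor A (comul a))
  rw [comul_mul_of_mem hb]
  induction comul (R := ℂ) a with
  | zero => simp
  | add x y hx hy => simp only [map_add, mul_add, hx, hy]
  | tmul p q => simp

/-- The map `Ê_φ : M ⋊ A → M`, `m ⋊ a ↦ m ((φ ⇀ a) ▷ 1)`. If `φ` is a left integral of `Â`, then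
`φ ⇀ a ∈ A_L`, so that `m ((φ ⇀ a) ▷ 1) ⋊ 1 = m ⋊ (φ ⇀ a)` and `Ê_φ` is the `M`-valued map
determined by `φ` through the dual action of `Â` on `M ⋊ A`. -/
def condExp (φ : Module.Dual ℂ A) : α.CrossedProduct →ₗ[M] M :=
  α.rel.liftQ
    { toFun := fun x => LinearMap.mul' ℂ M ((α.coaction 1 ∘ₗ hit φ).lTensor M x)
      map_add' := fun x y => by simp
      map_smul' := fun m x => by
        induction x with
        | zero => simp
        | add x y hx hy =>
          simp only [smul_add, map_add] at hx hy ⊢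
          rw [hx, hy]
        | tmul n a => simp [TensorProduct.smul_tmul', mul_assoc] }
    (by
      refine Submodule.span_le.2 ?_
      rintro _ ⟨m, b, a, hb, rfl⟩
      simp [coaction, hit_mul hb, α.mul_act, α.act_of_mem hb (α.act (hit φ a) 1), mul_assoc])

lemma condExp_cros (φ : Module.Dual ℂ A) (m : M) (a : A) :
    α.condExp φ (α.cros m a) = m * α.act (hit φ a) 1 := by
  change LinearMap.mul' ℂ M ((α.coaction 1 ∘ₗ hit φ).lTensor M (m ⊗ₜ[ℂ] a)) = _
  simp [coaction]

lemma condExp_smul (φ : Module.Dual ℂ A) (c : ℂ) (x : α.CrossedProduct) :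
    α.condExp φ (c • x) = c • α.condExp φ x := by
  obtain ⟨x, rfl⟩ := α.proj_surjective x
  change LinearMap.mul' ℂ M ((α.coaction 1 ∘ₗ hit φ).lTensor M (c • x)) =
    c • LinearMap.mul' ℂ M ((α.coaction 1 ∘ₗ hit φ).lTensor M x)
  simp

/-- The map `t_x : A → M`, `t_x(a) = Ê(a x)`, where `Ê = Ê_φ` and `a` stands for `1 ⋊ a`. -/
def implMap [FiniteDimensional ℂ A] (φ : Module.Dual ℂ A) (x : α.CrossedProduct) : A →ₗ[ℂ] M where
  toFun a := α.condExp φ (α.cros 1 a * x)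
  map_add' a b := by
    have h : α.cros 1 (a + b) = α.cros 1 a + α.cros 1 b := by
      simp only [cros, TensorProduct.tmul_add, map_add]
    rw [h, add_mul, map_add]
  map_smul' c a := by
    have h : α.cros 1 (c • a) = c • α.cros 1 a := by
      change α.projC _ = c • α.projC _
      simp only [TensorProduct.tmul_smul, map_smul]
    rw [h, smul_mul_cros, condExp_smul, RingHom.id_apply]

end ModuleAlgebra

end WeakHopf

end

/-! The inverse of x ↦ t_x is written down explicitly: it sends an implementer T to S(h₍₁₎)T(h₍₂₎),
where h is the Haar integral (`ofImplementer`). Two identities say that h and its dual integral λ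
form a system of dual bases: S(h₍₁₎)(λ ⇀ h₍₂₎a) = a (`sw_antipode_mul_hit`) and λ(aS(h₍₁₎))h₍₂₎ = a
(`sw_apply_mul_antipode`). The first recovers x from t_x, the second recovers T from S(h₍₁₎)T(h₍₂₎).
That t_x is an implementer follows from Ê being M-linear on both sides; linearity on the right holds
because λ ⇀ a lies in A_L, whose elements act on M as left multiplications.

For b in A_R one has Δ(ab) = a₍₁₎ ⊗ a₍₂₎b, hence t_b(a) = (a₍₁₎ ▷ 1)λ(a₍₂₎b). The left integrals of
the dual are exactly the functionals λ(·b) with b in A_R (`isDualLeftIntegral_iff_exists`), so 1 ⋊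
A_R is carried onto the trivial implementers. Outerness then says that the images of two submodules
under an injective map agree, which is part 3.

The integrals must be constructed. A finite dimensional C*-algebra is semisimple, so the left ideal
ker εt has a complement, and the component of 1 in it is a normalized left integral l. The element
ll⋆ is a two-sided integral, and positivity allows it to be renormalized by a central element, which
gives h. The dual integral is the trace a ↦ Tr(b ↦ aS²(b)). All this rests on the calculus of the
counital maps εt and εs (`targetMap`, `sourceMap`): A_L and A_R commute, and S is bijective and
reverses products and coproducts. -/

open scoped TensorProduct

noncomputable section

set_option linter.unusedSectionVars false

namespace WeakHopf

open Coalgebra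

/-! ### Linearity of unbundled functions, so that `fun_prop` can discharge it. -/

section Linearity

variable {V W U : Type*} [AddCommGroup V] [Module ℂ V] [AddCommGroup W] [Module ℂ W]
  [AddCommGroup U] [Module ℂ U]

/-- Linearity of an unbundled function, set up for automation. -/
@[fun_prop]
structure IsLin (f : V → W) : Prop where
  map_add : ∀ x y, f (x + y) = f x + f y
  map_smul : ∀ (c : ℂ) x, f (c • x) = c • f x

namespace IsLin

@[fun_prop]
lemma id : IsLin (fun x : V => x) := ⟨fun _ _ => rfl, fun _ _ => rfl⟩

@[fun_prop]
lemma comp {f : W → U} {g : V → W} (hf : IsLin f) (hg : IsLin g) : IsLin (fun x => f (g x)) :=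
  ⟨fun x y => by rw [hg.map_add, hf.map_add], fun c x => by rw [hg.map_smul, hf.map_smul]⟩

@[fun_prop]
lemma linearMap_apply (f : W →ₗ[ℂ] U) {g : V → W} (hg : IsLin g) : IsLin (fun x => f (g x)) :=
  ⟨fun x y => by rw [hg.map_add, _root_.map_add], fun c x => by rw [hg.map_smul, _root_.map_smul]⟩

@[fun_prop]
lemma linearMap_apply_const {f : V → W →ₗ[ℂ] U} (w : W) (hf : IsLin f) : IsLin (fun x => f x w) :=
  ⟨fun x y => by rw [hf.map_add, LinearMap.add_apply],
    fun c x => by rw [hf.map_smul, LinearMap.smul_apply]⟩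

@[fun_prop]
lemma const_smul {f : V → W} (c : ℂ) (hf : IsLin f) : IsLin (fun x => c • f x) :=
  ⟨fun x y => by rw [hf.map_add, smul_add], fun d x => by rw [hf.map_smul, smul_comm]⟩

@[fun_prop]
lemma smul_const {f : V → ℂ} (w : W) (hf : IsLin f) : IsLin (fun x => f x • w) :=
  ⟨fun x y => by rw [hf.map_add, add_smul], fun d x => by rw [hf.map_smul, smul_assoc]⟩

variable {R : Type*} [Ring R] [Module ℂ R]

@[fun_prop]
lemma mul_const [IsScalarTower ℂ R R] {f : V → R} (c : R) (hf : IsLin f) :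
    IsLin (fun x => f x * c) :=
  ⟨fun x y => by rw [hf.map_add, add_mul], fun d x => by rw [hf.map_smul, smul_mul_assoc]⟩

@[fun_prop]
lemma const_mul [SMulCommClass ℂ R R] {f : V → R} (c : R) (hf : IsLin f) :
    IsLin (fun x => c * f x) :=
  ⟨fun x y => by rw [hf.map_add, mul_add], fun d x => by rw [hf.map_smul, mul_smul_comm]⟩

lemma sum {ι : Type*} (s : Finset ι) {f : ι → V → W} (hf : ∀ i, IsLin (f i)) :
    IsLin (fun x => ∑ i ∈ s, f i x) :=
  ⟨fun x y => by simp only [(hf _).map_add, Finset.sum_add_distrib],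
    fun c x => by simp only [(hf _).map_smul, Finset.smul_sum]⟩

/-- The bundled form of a linear function. -/
def toLinearMap {f : V → W} (hf : IsLin f) : V →ₗ[ℂ] W := ⟨⟨f, hf.map_add⟩, hf.map_smul⟩

@[simp] lemma toLinearMap_apply {f : V → W} (hf : IsLin f) (x : V) : hf.toLinearMap x = f x := rfl

/-- The bundled form of a bilinear function. -/
def toBilin {f : V → W → U} (h₁ : ∀ y, IsLin (fun x => f x y)) (h₂ : ∀ x, IsLin (fun y => f x y)) :
    V →ₗ[ℂ] W →ₗ[ℂ] U :=
  LinearMap.mk₂ ℂ f (fun x x' y => (h₁ y).map_add x x') (fun c x y => (h₁ y).map_smul c x)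
    (fun x y y' => (h₂ x).map_add y y') (fun c x y => (h₂ x).map_smul c y)

@[simp] lemma toBilin_apply {f : V → W → U} (h₁ : ∀ y, IsLin (fun x => f x y))
    (h₂ : ∀ x, IsLin (fun y => f x y)) (x : V) (y : W) : toBilin h₁ h₂ x y = f x y := rfl

end IsLin

end Linearity

/-! ### Sweedler calculus, with coproducts written as finite sums over a basis. -/

section Sweedler

variable {A : Type*} [CStarAlgebra A] [FiniteDimensional ℂ A] [WeakCStarHopfAlgebra A]
  {V W : Type*} [AddCommGroup V] [Module ℂ V] [AddCommGroup W] [Module ℂ W]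

/-- The second legs of the coproduct with respect to a basis in the first tensor factor. -/
def slice (i : Fin (Module.finrank ℂ A)) : A →ₗ[ℂ] A :=
  (TensorProduct.lid ℂ A).toLinearMap ∘ₗ
    ((Module.finBasis ℂ A).coord i).rTensor A ∘ₗ comul

/-- The Sweedler sum `f(a₍₁₎, a₍₂₎)`. -/
def sw (a : A) (f : A → A → V) : V := ∑ i, f (Module.finBasis ℂ A i) (slice i a)

lemma comul_eq_sum (a : A) : comul (R := ℂ) a = ∑ i, Module.finBasis ℂ A i ⊗ₜ[ℂ] slice i a := by
  have key : ∀ t : A ⊗[ℂ] A, t = ∑ i, Module.finBasis ℂ A i ⊗ₜ[ℂ]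
      TensorProduct.lid ℂ A (((Module.finBasis ℂ A).coord i).rTensor A t) := by
    intro t
    induction t with
    | zero => simp
    | add t t' ht ht' =>
      simp only [map_add, TensorProduct.tmul_add, Finset.sum_add_distrib]
      rw [← ht, ← ht']
    | tmul a b =>
      simp only [LinearMap.rTensor_tmul, TensorProduct.lid_tmul, TensorProduct.tmul_smul,
        TensorProduct.smul_tmul', ← TensorProduct.sum_tmul]
      congr 1
      exact ((Module.finBasis ℂ A).sum_repr a).symm
  exact key _

lemma lift_comul (F : A →ₗ[ℂ] A →ₗ[ℂ] V) (a : A) :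
    TensorProduct.lift F (comul a) = sw a (fun x y => F x y) := by
  rw [comul_eq_sum, map_sum]; rfl

lemma apply_comul (F : A ⊗[ℂ] A →ₗ[ℂ] V) (a : A) :
    F (comul a) = sw a (fun x y => F (x ⊗ₜ[ℂ] y)) := by
  rw [comul_eq_sum, map_sum]; rfl

lemma comul_eq_sw (a : A) : comul (R := ℂ) a = sw a (fun x y => x ⊗ₜ[ℂ] y) := comul_eq_sum a

lemma sw_congr {a : A} {f g : A → A → V} (h : ∀ x y, f x y = g x y) : sw a f = sw a g := by
  simp only [sw, h]

@[fun_prop]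
lemma isLin_sw_left {g : W → A} {f : A → A → V} (hg : IsLin g) (hf : ∀ x, IsLin (fun y => f x y)) :
    IsLin (fun x => sw (g x) f) :=
  IsLin.sum _ fun i => (hf _).comp (hg.linearMap_apply (slice i))

@[fun_prop]
lemma isLin_sw_right {a : A} {f : W → A → A → V} (hf : ∀ x y, IsLin (fun w => f w x y)) :
    IsLin (fun w => sw a (f w)) :=
  IsLin.sum _ fun _ => hf _ _

lemma map_sw {F : Type*} [FunLike F V W] [AddMonoidHomClass F V W] (g : F) (a : A)
    (f : A → A → V) : g (sw a f) = sw a (fun x y => g (f x y)) := by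
  simp only [sw, map_sum]

lemma IsLin.map_sw {g : V → W} (hg : IsLin g) (a : A) (f : A → A → V) :
    g (sw a f) = sw a (fun x y => g (f x y)) :=
  WeakHopf.map_sw hg.toLinearMap a f

lemma mul_sw {R : Type*} [Ring R] [Module ℂ R] (c : R) (a : A) (f : A → A → R) :
    c * sw a f = sw a (fun x y => c * f x y) := by
  simp only [sw, Finset.mul_sum]

lemma sw_mul {R : Type*} [Ring R] [Module ℂ R] (c : R) (a : A) (f : A → A → R) :
    sw a f * c = sw a (fun x y => f x y * c) := by
  simp only [sw, Finset.sum_mul]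

lemma smul_sw (c : ℂ) (a : A) (f : A → A → V) : c • sw a f = sw a (fun x y => c • f x y) := by
  simp only [sw, Finset.smul_sum]

lemma sw_smul (v : V) (a : A) (f : A → A → ℂ) : sw a f • v = sw a (fun x y => f x y • v) := by
  simp only [sw, Finset.sum_smul]

lemma sw_comm (a b : A) (f : A → A → A → A → V) :
    sw a (fun x y => sw b (fun p q => f x y p q)) = sw b (fun p q => sw a (fun x y => f x y p q)) :=
  Finset.sum_comm

/-- Bilinear functions see only the coproduct. -/
lemma sw_eq_of_comul {a : A} {t : A ⊗[ℂ] A} (ht : comul a = t) (f : A → A → V)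
    (h₁ : ∀ y, IsLin (fun x => f x y) := by fun_prop)
    (h₂ : ∀ x, IsLin (fun y => f x y) := by fun_prop) :
    sw a f = TensorProduct.lift (IsLin.toBilin h₁ h₂) t := by
  rw [← ht, lift_comul]; rfl

lemma counit_sw (a : A) (g : A → V) (hg : IsLin g := by fun_prop) :
    sw a (fun x y => counit (R := ℂ) x • g y) = g a := by
  have h := congrArg (TensorProduct.lid ℂ A) (rTensor_counit_comul (R := ℂ) a)
  rw [LinearMap.rTensor, comul_eq_sum] at h
  simp only [map_sum, TensorProduct.map_tmul, TensorProduct.lid_tmul,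
    LinearMap.id_apply, one_smul] at h
  conv_rhs => rw [← h]
  exact ((IsLin.map_sw hg a (fun x y => counit (R := ℂ) x • y)).trans
    (sw_congr fun x y => hg.map_smul _ _)).symm

lemma sw_counit (a : A) (g : A → V) (hg : IsLin g := by fun_prop) :
    sw a (fun x y => counit (R := ℂ) y • g x) = g a := by
  have h := congrArg (TensorProduct.rid ℂ A) (lTensor_counit_comul (R := ℂ) a)
  rw [LinearMap.lTensor, comul_eq_sum] at h
  simp only [map_sum, TensorProduct.map_tmul, TensorProduct.rid_tmul,
    LinearMap.id_apply, one_smul] at h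
  conv_rhs => rw [← h]
  exact ((IsLin.map_sw hg a (fun x y => counit (R := ℂ) y • x)).trans
    (sw_congr fun x y => hg.map_smul _ _)).symm

/-- The bundled form of a trilinear function. -/
def toTrilin {f : A → A → A → V}
    (h₁ : ∀ y z, IsLin (fun x => f x y z)) (h₂ : ∀ x z, IsLin (fun y => f x y z))
    (h₃ : ∀ x y, IsLin (fun z => f x y z)) : A ⊗[ℂ] (A ⊗[ℂ] A) →ₗ[ℂ] V :=
  TensorProduct.lift (IsLin.toBilin (V := A) (W := A ⊗[ℂ] A)
    (f := fun x t => TensorProduct.lift (IsLin.toBilin (h₂ x) (h₃ x)) t)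
    -- Additivity in the first variable is needed for every tensor t, not only for pure ones, hence
    -- the induction.
    (fun t => by
      induction t with
      | zero => exact ⟨by simp, by simp⟩
      | add t t' ht ht' =>
        refine ⟨fun x y => ?_, fun c x => ?_⟩
        · rw [map_add, map_add, map_add, ht.map_add, ht'.map_add]; abel
        · rw [map_add, map_add, ht.map_smul, ht'.map_smul, smul_add]
      | tmul p q => exact h₁ p q)
    (fun x => by fun_prop))

lemma toTrilin_tmul {f : A → A → A → V}
    (h₁ : ∀ y z, IsLin (fun x => f x y z)) (h₂ : ∀ x z, IsLin (fun y => f x y z))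
    (h₃ : ∀ x y, IsLin (fun z => f x y z)) (x y z : A) :
    toTrilin h₁ h₂ h₃ (x ⊗ₜ[ℂ] (y ⊗ₜ[ℂ] z)) = f x y z := rfl

lemma sw_coassoc (a : A) (f : A → A → A → V)
    (h₁ : ∀ y z, IsLin (fun x => f x y z) := by fun_prop)
    (h₂ : ∀ x z, IsLin (fun y => f x y z) := by fun_prop)
    (h₃ : ∀ x y, IsLin (fun z => f x y z) := by fun_prop) :
    sw a (fun p z => sw p (fun x y => f x y z)) = sw a (fun x p => sw p (fun y z => f x y z)) := by
  have h := congrArg (toTrilin h₁ h₂ h₃) (coassoc_apply (R := ℂ) a)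
  rw [comul_eq_sum a] at h
  simpa only [sw, map_sum, LinearMap.rTensor_tmul, LinearMap.lTensor_tmul, comul_eq_sum,
    TensorProduct.sum_tmul, TensorProduct.tmul_sum, TensorProduct.assoc_tmul, toTrilin_tmul] using h

lemma sw_mul_arg (a b : A) (f : A → A → V)
    (h₁ : ∀ y, IsLin (fun x => f x y) := by fun_prop)
    (h₂ : ∀ x, IsLin (fun y => f x y) := by fun_prop) :
    sw (a * b) f = sw a (fun x y => sw b (fun p q => f (x * p) (y * q))) := by
  rw [sw_eq_of_comul (WeakCStarHopfAlgebra.comul_mul a b) f h₁ h₂, comul_eq_sum a, comul_eq_sum b]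
  simp only [Finset.sum_mul_sum, Algebra.TensorProduct.tmul_mul_tmul, map_sum]
  rfl

lemma sw_star_arg (a : A) (f : A → A → V)
    (h₁ : ∀ y, IsLin (fun x => f x y) := by fun_prop)
    (h₂ : ∀ x, IsLin (fun y => f x y) := by fun_prop) :
    sw (star a) f = sw a (fun x y => f (star x) (star y)) := by
  rw [sw_eq_of_comul (WeakCStarHopfAlgebra.comul_star a) f h₁ h₂, comul_eq_sum a, star_sum, map_sum]
  simp only [TensorProduct.star_tmul]
  rfl

lemma sw_one_sw_one (f : A → A → A → V)
    (h₁ : ∀ y z, IsLin (fun x => f x y z) := by fun_prop)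
    (h₂ : ∀ x z, IsLin (fun y => f x y z) := by fun_prop)
    (h₃ : ∀ x y, IsLin (fun z => f x y z) := by fun_prop) :
    sw (1 : A) (fun x y => sw (1 : A) (fun p q => f x (y * p) q)) =
      sw (1 : A) (fun x p => sw p (fun y z => f x y z)) := by
  have h := congrArg (toTrilin h₁ h₂ h₃) (WeakCStarHopfAlgebra.comul_one_mul (A := A))
  rw [comul_eq_sum (1 : A)] at h
  simpa only [sw, map_sum, LinearMap.lTensor_tmul, comul_eq_sum, Finset.sum_mul_sum,
    TensorProduct.sum_tmul, TensorProduct.tmul_sum, TensorProduct.assoc_tmul, toTrilin_tmul,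
    Algebra.TensorProduct.tmul_mul_tmul, one_mul, mul_one] using h

/-- The axioms fix one order of the two factors. Taking adjoints gives the other, since Δ(1) is
self-adjoint. -/
lemma comul_one_mul_rev : ((1 : A) ⊗ₜ[ℂ] comul (R := ℂ) (1 : A)) *
      TensorProduct.assoc ℂ A A A (comul (R := ℂ) (1 : A) ⊗ₜ[ℂ] (1 : A)) =
    comul.lTensor A (comul (1 : A)) := by
  have h := congrArg star (WeakCStarHopfAlgebra.comul_one_mul (A := A))
  have h1 : ∀ t : A ⊗[ℂ] A, star (TensorProduct.assoc ℂ A A A (t ⊗ₜ[ℂ] (1 : A))) =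
      TensorProduct.assoc ℂ A A A (star t ⊗ₜ[ℂ] (1 : A)) := by
    intro t
    induction t with
    | zero => simp
    | add t t' ht ht' => simp only [TensorProduct.add_tmul, map_add, star_add, ht, ht']
    | tmul a b => simp
  have h2 : ∀ t : A ⊗[ℂ] A, star ((comul (R := ℂ) (A := A)).lTensor A t) =
      (comul (R := ℂ) (A := A)).lTensor A (star t) := by
    intro t
    induction t with
    | zero => simp
    | add t t' ht ht' => simp only [map_add, star_add, ht, ht']
    | tmul a b => simp [WeakCStarHopfAlgebra.comul_star]
  rwa [star_mul, h1, h2, TensorProduct.star_tmul, star_one, star_comul_one] at h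

lemma sw_one_sw_one_rev (f : A → A → A → V)
    (h₁ : ∀ y z, IsLin (fun x => f x y z) := by fun_prop)
    (h₂ : ∀ x z, IsLin (fun y => f x y z) := by fun_prop)
    (h₃ : ∀ x y, IsLin (fun z => f x y z) := by fun_prop) :
    sw (1 : A) (fun p q => sw (1 : A) (fun x y => f x (p * y) q)) =
      sw (1 : A) (fun x p => sw p (fun y z => f x y z)) := by
  have h := congrArg (toTrilin h₁ h₂ h₃) (comul_one_mul_rev (A := A))
  rw [comul_eq_sum (1 : A)] at h
  simpa only [sw, map_sum, LinearMap.lTensor_tmul, comul_eq_sum, Finset.sum_mul_sum,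
    TensorProduct.sum_tmul, TensorProduct.tmul_sum, TensorProduct.assoc_tmul, toTrilin_tmul,
    Algebra.TensorProduct.tmul_mul_tmul, one_mul, mul_one] using h

lemma counit_mul_mul (x y z : A) : counit (R := ℂ) (x * y * z) =
    sw y (fun p q => counit (R := ℂ) (x * p) * counit (R := ℂ) (q * z)) := by
  rw [WeakCStarHopfAlgebra.counit_mul_mul, ← LinearMap.comp_apply, apply_comul]
  rfl

/-- The conjugate of ε is again a right counit for Δ. Evaluating ε and its conjugate on the two legs
of Δ(x) identifies them, as in the uniqueness of a unit. -/
lemma counit_star (x : A) : counit (R := ℂ) (star x) = star (counit (R := ℂ) x) := by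
  have h1 : sw x (fun p q => star (counit (R := ℂ) (star q)) • p) = x := by
    have := congrArg star (sw_counit (star x) (fun p => p))
    rw [star_star, sw_star_arg x (fun p q => counit (R := ℂ) q • p)] at this
    conv_rhs => rw [← this]
    simp only [sw, star_sum, star_smul, star_star]
  have h2 := congrArg (counit (R := ℂ)) h1
  rw [map_sw] at h2
  rw [← star_star (counit (star x)), ← h2]
  congr 1
  let ψ : A →ₗ[ℂ] ℂ :=
    { toFun := fun a => star (counit (R := ℂ) (star a))
      map_add' := fun a b => by simp
      map_smul' := fun c a => by simp }
  exact (counit_sw x ψ).symm.trans (sw_congr fun p q => by simp [ψ, mul_comm])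

/-- This is the adjoint of the counit axiom; the legs of y appear in the opposite order. -/
lemma counit_mul_mul_rev (x y z : A) : counit (R := ℂ) (x * y * z) =
    sw y (fun p q => counit (R := ℂ) (x * q) * counit (R := ℂ) (p * z)) := by
  have h := congrArg star (counit_mul_mul (star z) (star y) (star x))
  rw [← counit_star, star_mul, star_mul, star_star, star_star, star_star, ← mul_assoc,
    sw_star_arg y (fun p q => counit (R := ℂ) (star z * p) * counit (R := ℂ) (q * star x))] at h
  rw [h]
  simp only [sw, star_sum, star_mul', ← counit_star, star_mul, star_star, mul_comm]

end Sweedler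

/-! ### The counital maps εt and εs, and antimultiplicativity of the antipode. -/

section Antipode

variable {A : Type*} [CStarAlgebra A] [FiniteDimensional ℂ A] [WeakCStarHopfAlgebra A]
  {V W : Type*} [AddCommGroup V] [Module ℂ V] [AddCommGroup W] [Module ℂ W]

local notation "ε" => (counit : A →ₗ[ℂ] ℂ)
local notation "εt" => targetMap A
local notation "εs" => sourceMap A

/-- Identities of this kind carry an arbitrary linear g so that they can be applied inside a larger
Sweedler expression. -/
lemma apply_targetMap (a : A) (g : A → V) (hg : IsLin g := by fun_prop) :
    g (εt a) = sw a (fun x y => g (x * S A y)) := by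
  have h : εt a = sw a (fun x y => x * S A y) :=
    apply_comul (LinearMap.mul' ℂ A ∘ₗ (S A).lTensor A) a
  rw [h, hg.map_sw]

lemma apply_sourceMap (a : A) (g : A → V) (hg : IsLin g := by fun_prop) :
    g (εs a) = sw a (fun x y => g (S A x * y)) := by
  have h : εs a = sw a (fun x y => S A x * y) :=
    apply_comul (LinearMap.mul' ℂ A ∘ₗ (S A).rTensor A) a
  rw [h, hg.map_sw]

lemma apply_targetMap_one (a : A) (g : A → V) (hg : IsLin g := by fun_prop) :
    g (εt a) = sw 1 (fun x y => ε (x * a) • g y) := by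
  have h : εt a = sw 1 (fun x y => ε (x * a) • y) :=
    (targetMap_eq a).trans (apply_comul ((TensorProduct.lid ℂ A).toLinearMap ∘ₗ
      (counit ∘ₗ LinearMap.mulRight ℂ a).rTensor A) 1)
  rw [h, hg.map_sw]
  exact sw_congr fun x y => hg.map_smul _ _

lemma apply_sourceMap_one (a : A) (g : A → V) (hg : IsLin g := by fun_prop) :
    g (εs a) = sw 1 (fun x y => ε (a * y) • g x) := by
  have h : εs a = sw 1 (fun x y => ε (a * y) • x) :=
    (WeakCStarHopfAlgebra.antipode_mul a).trans (apply_comul ((TensorProduct.rid ℂ A).toLinearMap ∘ₗ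
      (counit ∘ₗ LinearMap.mulLeft ℂ a).lTensor A) 1)
  rw [h, hg.map_sw]
  exact sw_congr fun x y => hg.map_smul _ _

lemma sw_antipode_mul_target (a : A) (g : A → V) (hg : IsLin g := by fun_prop) :
    sw a (fun x y => g (S A x * εt y)) = g (S A a) := by
  rw [← hg.map_sw]
  exact congrArg g ((apply_comul (LinearMap.mul' ℂ A ∘ₗ TensorProduct.map (S A) εt) a).symm.trans
    (WeakCStarHopfAlgebra.antipode_mul_antipode a))

/-- Both this and `sw_antipode_mul_target` are bracketings of S(a₍₁₎)a₍₂₎S(a₍₃₎). -/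
lemma sw_source_mul_antipode (a : A) (g : A → V) (hg : IsLin g := by fun_prop) :
    sw a (fun x y => g (εs x * S A y)) = g (S A a) := by
  calc sw a (fun x y => g (εs x * S A y))
      = sw a (fun p z => sw p (fun x y => g (S A x * y * S A z))) :=
        sw_congr fun x y => apply_sourceMap x (fun u => g (u * S A y))
    _ = sw a (fun x p => sw p (fun y z => g (S A x * y * S A z))) :=
        sw_coassoc a (fun x y z => g (S A x * y * S A z))
    _ = sw a (fun x y => g (S A x * εt y)) :=
        sw_congr fun x y => by rw [apply_targetMap y (fun u => g (S A x * u))]; simp only [mul_assoc]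
    _ = _ := sw_antipode_mul_target a g

lemma sw_target_mul (a : A) (g : A → V) (hg : IsLin g := by fun_prop) :
    sw a (fun x y => g (εt x * y)) = g a := by
  rw [← hg.map_sw]
  exact congrArg g ((apply_comul (LinearMap.mul' ℂ A ∘ₗ (targetMap A).rTensor A) a).symm.trans
    (mul_targetMap a))

lemma sw_mul_source (a : A) (g : A → V) (hg : IsLin g := by fun_prop) :
    sw a (fun x y => g (x * εs y)) = g a := by
  calc sw a (fun x y => g (x * εs y))
      = sw a (fun x p => sw p (fun y z => g (x * S A y * z))) :=
        sw_congr fun x y => by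
          rw [apply_sourceMap y (fun u => g (x * u))]; simp only [mul_assoc]
    _ = sw a (fun p z => sw p (fun x y => g (x * S A y * z))) :=
        (sw_coassoc a (fun x y z => g (x * S A y * z))).symm
    _ = sw a (fun x y => g (εt x * y)) :=
        sw_congr fun x y => (apply_targetMap x (fun u => g (u * y))).symm
    _ = _ := sw_target_mul a g

/-- `εs(a₍₁₎) ⊗ a₍₂₎ = 1₍₁₎ ⊗ a 1₍₂₎`. -/
lemma sw_source_left (a : A) (f : A → A → V)
    (h₁ : ∀ y, IsLin (fun x => f x y) := by fun_prop)
    (h₂ : ∀ x, IsLin (fun y => f x y) := by fun_prop) :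
    sw a (fun x y => f (εs x) y) = sw 1 (fun x y => f x (a * y)) := by
  symm
  calc sw 1 (fun p q => f p (a * q))
      = sw 1 (fun p t => sw a (fun x y => sw t (fun r s => ε (x * r) • f p (y * s)))) :=
        sw_congr fun p q => by
          rw [← counit_sw (a * q) (fun u => f p u),
            sw_mul_arg a q (fun u v => ε u • f p v)]
    _ = sw a (fun x y => sw 1 (fun p t => sw t (fun r s => ε (x * r) • f p (y * s)))) :=
        sw_comm _ _ _
    -- Splitting Δ²(1) into two copies of Δ(1) detaches p; the other copy is then absorbed into a·1.
    _ = sw a (fun x y => sw 1 (fun r s => sw 1 (fun p q => ε (x * (r * q)) • f p (y * s)))) :=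
        sw_congr fun x y =>
          (sw_one_sw_one_rev (fun p r s => ε (x * r) • f p (y * s))).symm
    _ = sw (a * 1) (fun x y => sw 1 (fun p q => ε (x * q) • f p y)) := by
        rw [sw_mul_arg a 1 (fun x y => sw 1 (fun p q => ε (x * q) • f p y))]
        simp only [mul_assoc]
    _ = sw a (fun x y => f (εs x) y) := by
        rw [mul_one]
        exact sw_congr fun x y => (apply_sourceMap_one x (fun u => f u y)).symm

/-- `a₍₁₎ ⊗ εt(a₍₂₎) = 1₍₁₎ a ⊗ 1₍₂₎`. -/
lemma sw_target_right (a : A) (f : A → A → V)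
    (h₁ : ∀ y, IsLin (fun x => f x y) := by fun_prop)
    (h₂ : ∀ x, IsLin (fun y => f x y) := by fun_prop) :
    sw a (fun x y => f x (εt y)) = sw 1 (fun x y => f (x * a) y) := by
  symm
  calc sw 1 (fun p q => f (p * a) q)
      = sw 1 (fun t q => sw t (fun r s => sw a (fun x y => ε (s * y) • f (r * x) q))) :=
        sw_congr fun p q => by
          rw [← sw_counit (p * a) (fun u => f u q),
            sw_mul_arg p a (fun u v => ε v • f u q)]
    _ = sw 1 (fun r t => sw t (fun s q => sw a (fun x y => ε (s * y) • f (r * x) q))) :=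
        sw_coassoc 1 (fun r s q => sw a (fun x y => ε (s * y) • f (r * x) q))
    _ = sw 1 (fun p q => sw 1 (fun r s => sw a (fun x y => ε (p * s * y) • f (r * x) q))) :=
        (sw_one_sw_one_rev (fun r s q => sw a (fun x y => ε (s * y) • f (r * x) q))).symm
    _ = sw 1 (fun p q => sw (1 * a) (fun x y => ε (p * y) • f x q)) :=
        sw_congr fun p q => by
          rw [sw_mul_arg 1 a (fun x y => ε (p * y) • f x q)]
          simp only [mul_assoc]
    _ = sw a (fun x y => f x (εt y)) := by
        rw [one_mul, sw_comm]
        exact sw_congr fun x y => (apply_targetMap_one y (fun u => f x u)).symm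

/-- `ε(c a₍₁₎) a₍₂₎ = ε(c 1₍₁₎) 1₍₂₎ a`. -/
lemma sw_counit_mul_left (c a : A) (g : A → V) (hg : IsLin g := by fun_prop) :
    sw a (fun x y => ε (c * x) • g y) = sw 1 (fun x y => ε (c * x) • g (y * a)) := by
  symm
  calc sw 1 (fun x y => ε (c * x) • g (y * a))
      = sw 1 (fun x t => sw t (fun r s => sw a (fun p q => (ε (c * x) * ε (r * p)) • g (s * q)))) :=
        sw_congr fun x y => by
          rw [← counit_sw (y * a) g, sw_mul_arg y a (fun u v => ε u • g v)]
          simp only [smul_sw, mul_smul]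
    _ = sw 1 (fun t s => sw t (fun x r => sw a (fun p q => (ε (c * x) * ε (r * p)) • g (s * q)))) :=
        (sw_coassoc 1 (fun x r s => sw a (fun p q => (ε (c * x) * ε (r * p)) • g (s * q)))
          (by simp only [mul_smul]; fun_prop) (by simp only [mul_smul]; fun_prop)
          (by fun_prop)).symm
    _ = sw 1 (fun t s => sw a (fun p q => ε (c * (t * p)) • g (s * q))) :=
        sw_congr fun t s => by
          rw [sw_comm]
          simp only [← sw_smul, ← counit_mul_mul, mul_assoc]
    _ = sw (1 * a) (fun x y => ε (c * x) • g y) :=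
        (sw_mul_arg 1 a (fun x y => ε (c * x) • g y)).symm
    _ = _ := by rw [one_mul]

/-- `a₍₁₎ ε(a₍₂₎ c) = a 1₍₁₎ ε(1₍₂₎ c)`. -/
lemma sw_counit_mul_right (a c : A) (g : A → V) (hg : IsLin g := by fun_prop) :
    sw a (fun x y => ε (y * c) • g x) = sw 1 (fun x y => ε (y * c) • g (a * x)) := by
  symm
  calc sw 1 (fun x y => ε (y * c) • g (a * x))
      = sw 1 (fun t y => sw t (fun r s => sw a (fun p q => (ε (q * s) * ε (y * c)) • g (p * r)))) :=
        sw_congr fun x y => by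
          rw [← sw_counit (a * x) g, sw_mul_arg a x (fun u v => ε v • g u), sw_comm]
          simp only [smul_sw, smul_smul, mul_comm]
    _ = sw 1 (fun r t => sw t (fun s y => sw a (fun p q => (ε (q * s) * ε (y * c)) • g (p * r)))) :=
        sw_coassoc 1 (fun r s y => sw a (fun p q => (ε (q * s) * ε (y * c)) • g (p * r)))
          (by simp only [mul_smul]; fun_prop) (by simp only [mul_smul]; fun_prop)
          (by simp only [mul_smul]; fun_prop)
    _ = sw 1 (fun r t => sw a (fun p q => ε (q * t * c) • g (p * r))) :=
        sw_congr fun t s => by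
          rw [sw_comm]
          simp only [← sw_smul, ← counit_mul_mul]
    _ = sw (a * 1) (fun x y => ε (y * c) • g x) := by
        rw [sw_comm]
        exact (sw_mul_arg a 1 (fun x y => ε (y * c) • g x)).symm
    _ = _ := by rw [mul_one]

lemma sw_one_source (f : A → A → V)
    (h₁ : ∀ y, IsLin (fun x => f x y) := by fun_prop)
    (h₂ : ∀ x, IsLin (fun y => f x y) := by fun_prop) :
    sw 1 (fun x y => f (εs x) y) = sw 1 f := by
  rw [sw_source_left 1 f]; simp only [one_mul]

lemma sw_one_target (f : A → A → V)
    (h₁ : ∀ y, IsLin (fun x => f x y) := by fun_prop)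
    (h₂ : ∀ x, IsLin (fun y => f x y) := by fun_prop) :
    sw 1 (fun x y => f x (εt y)) = sw 1 f := by
  rw [sw_target_right 1 f]; simp only [mul_one]

@[simp] lemma source_source (a : A) : εs (εs a) = εs a := by
  rw [apply_sourceMap_one a (fun u => εs u), apply_sourceMap_one a (fun u => u)]
  exact sw_one_source (fun x y => ε (a * y) • x)

@[simp] lemma target_target (a : A) : εt (εt a) = εt a := by
  rw [apply_targetMap_one a (fun u => εt u), apply_targetMap_one a (fun u => u)]
  exact sw_one_target (fun x y => ε (x * a) • y)

@[simp] lemma target_one : εt (1 : A) = 1 := by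
  rw [apply_targetMap_one 1 (fun u => u)]
  simp only [mul_one]
  exact counit_sw 1 (fun u => u)

@[simp] lemma source_one : εs (1 : A) = 1 := by
  rw [apply_sourceMap_one 1 (fun u => u)]
  simp only [one_mul]
  exact sw_counit 1 (fun u => u)

-- Writing εt(b) through Δ(1) turns the left side into the reversed counit axiom with middle factor
-- 1.
@[simp] lemma counit_mul_target (a b : A) : ε (a * εt b) = ε (a * b) := by
  rw [apply_targetMap_one b (fun u => ε (a * u)), ← mul_one a, mul_assoc, ← mul_assoc,
    counit_mul_mul_rev]
  exact sw_congr fun x y => by rw [mul_one, smul_eq_mul, mul_comm]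

@[simp] lemma counit_source_mul (a b : A) : ε (εs a * b) = ε (a * b) := by
  rw [apply_sourceMap_one a (fun u => ε (u * b)), ← mul_one a, counit_mul_mul_rev]
  exact sw_congr fun x y => by rw [mul_one, smul_eq_mul]

@[simp] lemma counit_target (a : A) : ε (εt a) = ε a := by
  simpa using counit_mul_target 1 a

@[simp] lemma counit_source (a : A) : ε (εs a) = ε a := by
  simpa using counit_source_mul a 1

@[simp] lemma target_mul_target (a b : A) : εt (a * εt b) = εt (a * b) := by
  rw [apply_targetMap_one (a * εt b) (fun u => u), apply_targetMap_one (a * b) (fun u => u)]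
  simp only [← mul_assoc, counit_mul_target]

@[simp] lemma source_source_mul (a b : A) : εs (εs a * b) = εs (a * b) := by
  rw [apply_sourceMap_one (εs a * b) (fun u => u), apply_sourceMap_one (a * b) (fun u => u)]
  simp only [mul_assoc, counit_source_mul]

/-- `A_L` and `A_R` commute. -/
lemma source_mul_target (a b : A) : εs a * εt b = εt b * εs a := by
  -- Both orders of multiplying two copies of Δ(1) give Δ²(1). Evaluating the outer legs with ε(·b)
  -- and ε(a·) leaves the two products in the middle.
  have h := (sw_one_sw_one (fun x y z : A => ε (x * b) • ε (a * z) • y)).trans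
    (sw_one_sw_one_rev (fun x y z : A => ε (x * b) • ε (a * z) • y)).symm
  rw [apply_sourceMap_one a (fun u => u * εt b), apply_sourceMap_one a (fun u => εt b * u)]
  calc sw 1 (fun p q => ε (a * q) • (p * εt b))
      = sw 1 (fun p q => sw 1 (fun x y => ε (x * b) • ε (a * q) • (p * y))) :=
        sw_congr fun p q => by
          rw [apply_targetMap_one b (fun u => ε (a * q) • (p * u))]
    _ = _ := h.symm
    _ = sw 1 (fun p q => sw 1 (fun x y => ε (x * b) • ε (a * q) • (y * p))) := sw_comm _ _ _
    _ = _ := sw_congr fun p q => by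
          rw [apply_targetMap_one b (fun u => ε (a * q) • (u * p))]

lemma sw_target_mul_arg (b x : A) (f : A → A → V)
    (h₁ : ∀ y, IsLin (fun x => f x y) := by fun_prop)
    (h₂ : ∀ x, IsLin (fun y => f x y) := by fun_prop) :
    sw (εt b * x) f = sw x (fun p q => f (εt b * p) q) := by
  rw [sw_eq_of_comul (comul_mul_of_mem (targetMap_mem b) x) f h₁ h₂, comul_eq_sum x,
    Finset.mul_sum, map_sum]
  simp only [Algebra.TensorProduct.tmul_mul_tmul, one_mul]
  rfl

lemma sw_mul_target_arg (x b : A) (f : A → A → V)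
    (h₁ : ∀ y, IsLin (fun x => f x y) := by fun_prop)
    (h₂ : ∀ x, IsLin (fun y => f x y) := by fun_prop) :
    sw (x * εt b) f = sw x (fun p q => f (p * εt b) q) := by
  rw [sw_eq_of_comul (comul_mul_of_mem' (targetMap_mem b) x) f h₁ h₂, comul_eq_sum x,
    Finset.sum_mul, map_sum]
  simp only [Algebra.TensorProduct.tmul_mul_tmul, mul_one]
  rfl

/-- The element εs(a) is a slice of Δ(1) along its second leg, so its coproduct is a slice of Δ²(1).
Factoring Δ²(1) into two copies of Δ(1) turns that slice back into εs(a) on the second leg. The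
opposite factorization puts εs(a) on the left of that leg. -/
lemma sw_source_arg (a : A) (f : A → A → V)
    (h₁ : ∀ y, IsLin (fun x => f x y) := by fun_prop)
    (h₂ : ∀ x, IsLin (fun y => f x y) := by fun_prop) :
    sw (εs a) f = sw 1 (fun p q => f p (q * εs a)) := by
  calc sw (εs a) f = sw 1 (fun p z => sw p (fun x y => ε (a * z) • f x y)) := by
        rw [apply_sourceMap_one a (fun u => sw u f)]
        simp only [smul_sw]
    _ = sw 1 (fun x p => sw p (fun y z => ε (a * z) • f x y)) :=
        sw_coassoc 1 (fun x y z => ε (a * z) • f x y)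
    _ = sw 1 (fun x y => sw 1 (fun p q => ε (a * q) • f x (y * p))) :=
        (sw_one_sw_one (fun x y z => ε (a * z) • f x y)).symm
    _ = _ := sw_congr fun x y => (apply_sourceMap_one a (fun u => f x (y * u))).symm

lemma sw_source_arg_rev (a : A) (f : A → A → V)
    (h₁ : ∀ y, IsLin (fun x => f x y) := by fun_prop)
    (h₂ : ∀ x, IsLin (fun y => f x y) := by fun_prop) :
    sw (εs a) f = sw 1 (fun p q => f p (εs a * q)) := by
  calc sw (εs a) f = sw 1 (fun p z => sw p (fun x y => ε (a * z) • f x y)) := by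
        rw [apply_sourceMap_one a (fun u => sw u f)]
        simp only [smul_sw]
    _ = sw 1 (fun x p => sw p (fun y z => ε (a * z) • f x y)) :=
        sw_coassoc 1 (fun x y z => ε (a * z) • f x y)
    _ = sw 1 (fun p q => sw 1 (fun x y => ε (a * q) • f x (p * y))) :=
        (sw_one_sw_one_rev (fun x y z => ε (a * z) • f x y)).symm
    _ = sw 1 (fun x y => sw 1 (fun p q => ε (a * q) • f x (p * y))) := sw_comm _ _ _
    _ = _ := sw_congr fun x y => (apply_sourceMap_one a (fun u => f x (u * y))).symm

lemma sw_source_mul_arg (a x : A) (f : A → A → V)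
    (h₁ : ∀ y, IsLin (fun x => f x y) := by fun_prop)
    (h₂ : ∀ x, IsLin (fun y => f x y) := by fun_prop) :
    sw (εs a * x) f = sw x (fun p q => f p (εs a * q)) := by
  calc sw (εs a * x) f
      = sw 1 (fun p q => sw x (fun r s => f (p * r) (εs a * q * s))) := by
        rw [sw_mul_arg (εs a) x f, sw_source_arg_rev a (fun p q => sw x (fun r s => f (p * r) (q * s)))]
    _ = sw (1 * x) (fun p q => f p (εs a * q)) := by
        rw [sw_mul_arg 1 x (fun p q => f p (εs a * q))]
        simp only [mul_assoc]
    _ = _ := by rw [one_mul]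

lemma sw_mul_source_arg (x a : A) (f : A → A → V)
    (h₁ : ∀ y, IsLin (fun x => f x y) := by fun_prop)
    (h₂ : ∀ x, IsLin (fun y => f x y) := by fun_prop) :
    sw (x * εs a) f = sw x (fun p q => f p (q * εs a)) := by
  calc sw (x * εs a) f
      = sw 1 (fun p q => sw x (fun r s => f (r * p) (s * (q * εs a)))) := by
        rw [sw_mul_arg x (εs a) f, sw_comm,
          sw_source_arg a (fun p q => sw x (fun r s => f (r * p) (s * q)))]
    _ = sw (x * 1) (fun p q => f p (q * εs a)) := by
        rw [sw_mul_arg x 1 (fun p q => f p (q * εs a)), sw_comm]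
        simp only [mul_assoc]
    _ = _ := by rw [mul_one]

@[simp] lemma target_target_mul (a b : A) : εt (εt a * b) = εt a * εt b := by
  rw [apply_targetMap (εt a * b) (fun u => u), apply_targetMap b (fun u => εt a * u),
    sw_target_mul_arg a b (fun x y => x * S A y)]
  simp only [mul_assoc]

@[simp] lemma source_mul_source (a b : A) : εs (a * εs b) = εs a * εs b := by
  rw [apply_sourceMap (a * εs b) (fun u => u), apply_sourceMap a (fun u => u * εs b),
    sw_mul_source_arg a b (fun x y => S A x * y)]
  simp only [mul_assoc]

/-- For b in A_L, S(b) = S(b₍₁₎)εt(b₍₂₎) = S(1₍₁₎b)1₍₂₎, and 1₍₁₎b ⊗ 1₍₂₎ is again Δ(b). So S agrees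
with εs on A_L; symmetrically, it agrees with εt on A_R. -/
lemma antipode_target (b : A) : S A (εt b) = εs (εt b) := by
  calc S A (εt b) = sw (εt b) (fun x y => S A x * εt y) :=
        (sw_antipode_mul_target (εt b) (fun u => u)).symm
    _ = sw 1 (fun x y => S A (x * εt b) * y) :=
        sw_target_right (εt b) (fun x y => S A x * y)
    _ = sw (1 * εt b) (fun x y => S A x * y) :=
        (sw_mul_target_arg 1 b (fun x y => S A x * y)).symm
    _ = εs (εt b) := by rw [one_mul, ← apply_sourceMap _ (fun u => u)]

lemma antipode_source (a : A) : S A (εs a) = εt (εs a) := by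
  calc S A (εs a) = sw (εs a) (fun x y => εs x * S A y) :=
        (sw_source_mul_antipode (εs a) (fun u => u)).symm
    _ = sw 1 (fun x y => x * S A (εs a * y)) :=
        sw_source_left (εs a) (fun x y => x * S A y)
    _ = sw (εs a * 1) (fun x y => x * S A y) :=
        (sw_source_mul_arg a 1 (fun x y => x * S A y)).symm
    _ = εt (εs a) := by rw [mul_one, ← apply_targetMap _ (fun u => u)]

@[simp] lemma antipode_one : S A (1 : A) = 1 := by
  simpa using antipode_target (1 : A)

/-- `εt(a₍₁₎) ⊗ a₍₂₎ = S(1₍₁₎) ⊗ 1₍₂₎ a`. -/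
lemma sw_target_left (a : A) (f : A → A → V)
    (h₁ : ∀ y, IsLin (fun x => f x y) := by fun_prop)
    (h₂ : ∀ x, IsLin (fun y => f x y) := by fun_prop) :
    sw a (fun x y => f (εt x) y) = sw 1 (fun x y => f (S A x) (y * a)) := by
  -- The first leg of Δ(1) lies in A_R, where εt and S coincide.
  have hone : sw (1 : A) (fun x y => f (εt x) (y * a)) = sw 1 (fun x y => f (S A x) (y * a)) := by
    rw [← sw_one_source (fun x y => f (S A x) (y * a)),
      ← sw_one_source (fun x y => f (εt x) (y * a))]
    simp only [antipode_source]
  rw [← hone]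
  calc sw a (fun x y => f (εt x) y)
      = sw a (fun x y => sw 1 (fun p q => ε (p * x) • f q y)) :=
        sw_congr fun x y => apply_targetMap_one x (fun u => f u y)
    _ = sw 1 (fun p q => sw a (fun x y => ε (p * x) • f q y)) := sw_comm _ _ _
    _ = sw 1 (fun p q => sw 1 (fun x y => ε (p * x) • f q (y * a))) :=
        sw_congr fun p q => sw_counit_mul_left p a (fun u => f q u)
    _ = sw 1 (fun x y => sw 1 (fun p q => ε (p * x) • f q (y * a))) := sw_comm _ _ _
    _ = _ := sw_congr fun x y => (apply_targetMap_one x (fun u => f u (y * a))).symm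

/-- `a₍₁₎ ⊗ εs(a₍₂₎) = a 1₍₁₎ ⊗ S(1₍₂₎)`. -/
lemma sw_source_right (a : A) (f : A → A → V)
    (h₁ : ∀ y, IsLin (fun x => f x y) := by fun_prop)
    (h₂ : ∀ x, IsLin (fun y => f x y) := by fun_prop) :
    sw a (fun x y => f x (εs y)) = sw 1 (fun x y => f (a * x) (S A y)) := by
  have hone : sw (1 : A) (fun x y => f (a * x) (εs y)) = sw 1 (fun x y => f (a * x) (S A y)) := by
    rw [← sw_one_target (fun x y => f (a * x) (S A y)),
      ← sw_one_target (fun x y => f (a * x) (εs y))]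
    simp only [antipode_target]
  rw [← hone]
  calc sw a (fun x y => f x (εs y))
      = sw a (fun x y => sw 1 (fun p q => ε (y * q) • f x p)) :=
        sw_congr fun x y => apply_sourceMap_one y (fun u => f x u)
    _ = sw 1 (fun p q => sw a (fun x y => ε (y * q) • f x p)) := sw_comm _ _ _
    _ = sw 1 (fun p q => sw 1 (fun x y => ε (y * q) • f (a * x) p)) :=
        sw_congr fun p q => sw_counit_mul_right a q (fun u => f u p)
    _ = sw 1 (fun x y => sw 1 (fun p q => ε (y * q) • f (a * x) p)) := sw_comm _ _ _
    _ = _ := sw_congr fun x y => (apply_sourceMap_one y (fun u => f (a * x) u)).symm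

/-- `S(1₍₁₎) ⊗ S(1₍₂₎) = 1₍₂₎ ⊗ 1₍₁₎`. -/
lemma sw_one_antipode (f : A → A → V)
    (h₁ : ∀ y, IsLin (fun x => f x y) := by fun_prop)
    (h₂ : ∀ x, IsLin (fun y => f x y) := by fun_prop) :
    sw 1 (fun x y => f (S A x) (S A y)) = sw 1 (fun x y => f y x) := by
  calc sw 1 (fun x y => f (S A x) (S A y))
      = sw 1 (fun x y => f (S A x) (S A (y * 1))) := by simp only [mul_one]
    _ = sw 1 (fun x y => f (εt x) (S A y)) := (sw_target_left 1 (fun x y => f x (S A y))).symm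
    _ = sw 1 (fun x y => f (εt (1 * x)) (S A y)) := by simp only [one_mul]
    _ = sw 1 (fun x y => f (εt x) (εs y)) := (sw_source_right 1 (fun x y => f (εt x) y)).symm
    _ = sw 1 (fun x y => sw 1 (fun p q => sw 1 (fun r s => (ε (p * x) * ε (y * s)) • f q r))) :=
        sw_congr fun x y => by
          rw [apply_targetMap_one x (fun u => f u (εs y))]
          refine sw_congr fun p q => ?_
          rw [apply_sourceMap_one y (fun u => f q u), smul_sw]
          simp only [mul_smul]
    _ = sw 1 (fun p q => sw 1 (fun x y => sw 1 (fun r s => (ε (p * x) * ε (y * s)) • f q r))) :=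
        sw_comm _ _ _
    -- The counit axiom contracts the middle copy of Δ(1).
    _ = sw 1 (fun p q => sw 1 (fun r s => ε (p * s) • f q r)) :=
        sw_congr fun p q => by
          rw [sw_comm]
          refine sw_congr fun r s => ?_
          rw [← sw_smul, ← counit_mul_mul, mul_one]
    _ = sw 1 (fun p q => f q (εs p)) :=
        sw_congr fun p q => (apply_sourceMap_one p (fun u => f q u)).symm
    _ = _ := sw_one_source (fun x y => f y x)

/-- As for Hopf algebras, S(x₍₁₎y₍₁₎)x₍₂₎y₍₂₎S(y₍₃₎)S(x₍₃₎) is evaluated in two ways. Collapsing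
from the right gives S(xy); collapsing from the left gives εs(x₍₁₎y₍₁₎)S(y₍₂₎)S(x₍₂₎), where εs is
no longer scalar and has to be moved past εt. -/
lemma antipode_mul (x y : A) : S A (x * y) = S A y * S A x := by
  have h1 : ∀ a b : A, sw a (fun p q => p * εt b * S A q) = εt (a * b) := fun a b => by
    rw [← target_mul_target, apply_targetMap (a * εt b) (fun u => u),
      sw_mul_target_arg a b (fun u v => u * S A v)]
  have h2 : ∀ a b : A, sw b (fun p q => S A p * εs a * q) = εs (a * b) := fun a b => by
    rw [← source_source_mul, apply_sourceMap (εs a * b) (fun u => u),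
      sw_source_mul_arg a b (fun u v => S A u * v)]
    simp only [mul_assoc]
  calc S A (x * y)
      = sw (x * y) (fun a b => S A a * εt b) := (sw_antipode_mul_target _ (fun u => u)).symm
    _ = sw x (fun a p => sw y (fun c d => sw p (fun r s => S A (a * c) * (r * εt d * S A s)))) := by
        rw [sw_mul_arg x y (fun a b => S A a * εt b)]
        simp only [← mul_sw, h1]
    _ = sw x (fun a p => sw p (fun r s => sw y (fun c d => S A (a * c) * (r * εt d * S A s)))) :=
        sw_congr fun a p => sw_comm _ _ _
    _ = sw x (fun p s => sw p (fun a r => sw y (fun c d => S A (a * c) * (r * εt d * S A s)))) :=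
        (sw_coassoc x (fun a r s => sw y (fun c d => S A (a * c) * (r * εt d * S A s)))).symm
    _ = sw x (fun p s => sw p (fun a r => sw y (fun c t => sw t (fun d e =>
          S A (a * c) * (r * d) * S A e * S A s)))) := by
        refine sw_congr fun p s => sw_congr fun a r => sw_congr fun c t => ?_
        rw [apply_targetMap t (fun u => S A (a * c) * (r * u * S A s))]
        simp only [mul_assoc]
    _ = sw x (fun p s => sw p (fun a r => sw y (fun t e => sw t (fun c d =>
          S A (a * c) * (r * d) * S A e * S A s)))) := by
        refine sw_congr fun p s => sw_congr fun a r => ?_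
        exact (sw_coassoc y (fun c d e => S A (a * c) * (r * d) * S A e * S A s)).symm
    _ = sw x (fun p s => sw y (fun t e => εs (p * t) * S A e * S A s)) := by
        refine sw_congr fun p s => ?_
        rw [sw_comm]
        refine sw_congr fun t e => ?_
        rw [apply_sourceMap (p * t) (fun u => u * S A e * S A s),
          sw_mul_arg p t (fun u v => S A u * v * S A e * S A s)]
    _ = sw x (fun p s => sw y (fun t e => sw t (fun c d => S A c * εs p * d * S A e * S A s))) := by
        simp only [← sw_mul, h2]
    _ = sw x (fun p s => sw y (fun c t => sw t (fun d e => S A c * εs p * d * S A e * S A s))) :=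
        sw_congr fun p s => sw_coassoc y (fun c d e => S A c * εs p * d * S A e * S A s)
    _ = sw x (fun p s => sw y (fun c t => S A c * εt t * (εs p * S A s))) := by
        refine sw_congr fun p s => sw_congr fun c t => ?_
        -- Commutation of A_L with A_R separates the factors belonging to y from those belonging to
        -- x.
        rw [mul_assoc (S A c), ← mul_assoc (εt t), ← source_mul_target,
          apply_targetMap t (fun u => S A c * (εs p * u * S A s))]
        simp only [mul_assoc]
    _ = S A y * S A x := by
        simp only [← sw_mul, ← mul_sw, sw_antipode_mul_target y (fun u => u),
          sw_source_mul_antipode x (fun u => u)]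

end Antipode

namespace IsLin

variable {V W U : Type*} [AddCommGroup V] [Module ℂ V] [AddCommGroup W] [Module ℂ W]
  [AddCommGroup U] [Module ℂ U]

@[fun_prop]
lemma tmul_const {f : V → W} (u : U) (hf : IsLin f) : IsLin (fun x => f x ⊗ₜ[ℂ] u) :=
  ⟨fun x y => by rw [hf.map_add, TensorProduct.add_tmul],
    fun c x => by rw [hf.map_smul, TensorProduct.smul_tmul']⟩

@[fun_prop]
lemma const_tmul {f : V → W} (u : U) (hf : IsLin f) : IsLin (fun x => u ⊗ₜ[ℂ] f x) :=
  ⟨fun x y => by rw [hf.map_add, TensorProduct.tmul_add],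
    fun c x => by rw [hf.map_smul, TensorProduct.tmul_smul]⟩

end IsLin

/-! ### The antipode reverses coproducts and is bijective. -/

section Antipode

variable {A : Type*} [CStarAlgebra A] [FiniteDimensional ℂ A] [WeakCStarHopfAlgebra A]
  {V W : Type*} [AddCommGroup V] [Module ℂ V] [AddCommGroup W] [Module ℂ W]

local notation "ε" => (counit : A →ₗ[ℂ] ℂ)
local notation "εt" => targetMap A
local notation "εs" => sourceMap A
local notation "Δ" => (comul : A →ₗ[ℂ] A ⊗[ℂ] A)

/-- The map a ↦ S(a₍₂₎) ⊗ S(a₍₁₎) is a left convolution inverse of Δ up to the factor Δ∘εs: in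
S(a₍₂₎)a₍₃₎ ⊗ S(a₍₁₎)a₍₄₎ the inner pair collapses first, then the outer one. -/
lemma sw_antipode_tmul_mul_comul (a : A) :
    sw a (fun p z => sw p (fun x y => S A y ⊗ₜ[ℂ] S A x) * Δ z) = Δ (εs a) := by
  calc sw a (fun p z => sw p (fun x y => S A y ⊗ₜ[ℂ] S A x) * Δ z)
      = sw a (fun p z => sw p (fun x y => sw z (fun u v =>
          (S A y * u) ⊗ₜ[ℂ] (S A x * v)))) := by
        simp only [comul_eq_sw, mul_sw, sw_mul, Algebra.TensorProduct.tmul_mul_tmul]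
        exact sw_congr fun p z => sw_comm _ _ _
    _ = sw a (fun x p => sw p (fun y z => sw z (fun u v =>
          (S A y * u) ⊗ₜ[ℂ] (S A x * v)))) :=
        sw_coassoc a (fun x y z => sw z (fun u v => (S A y * u) ⊗ₜ[ℂ] (S A x * v)))
    _ = sw a (fun x p => sw p (fun q v => sw q (fun y u =>
          (S A y * u) ⊗ₜ[ℂ] (S A x * v)))) :=
        sw_congr fun x p => (sw_coassoc p (fun y u v => (S A y * u) ⊗ₜ[ℂ] (S A x * v))).symm
    _ = sw a (fun x p => sw p (fun q v => εs q ⊗ₜ[ℂ] (S A x * v))) :=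
        sw_congr fun x p => sw_congr fun q v =>
          (apply_sourceMap q (fun u => u ⊗ₜ[ℂ] (S A x * v))).symm
    _ = sw a (fun x p => sw 1 (fun r s => r ⊗ₜ[ℂ] (S A x * (p * s)))) :=
        sw_congr fun x p => sw_source_left p (fun q v => q ⊗ₜ[ℂ] (S A x * v))
    _ = sw 1 (fun r s => sw a (fun x p => r ⊗ₜ[ℂ] (S A x * (p * s)))) := sw_comm _ _ _
    _ = sw 1 (fun r s => r ⊗ₜ[ℂ] (εs a * s)) :=
        sw_congr fun r s => by
          rw [apply_sourceMap a (fun u => r ⊗ₜ[ℂ] (u * s))]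
          simp only [mul_assoc]
    _ = sw (εs a) (fun r s => r ⊗ₜ[ℂ] s) := (sw_source_arg_rev a (fun r s => r ⊗ₜ[ℂ] s)).symm
    _ = Δ (εs a) := (comul_eq_sw _).symm

lemma sw_antipode_tmul_mul_comul_target (a : A) :
    sw a (fun p z => sw p (fun x y => S A y ⊗ₜ[ℂ] S A x) * Δ (εt z)) =
      sw a (fun x y => S A y ⊗ₜ[ℂ] S A x) := by
  calc sw a (fun p z => sw p (fun x y => S A y ⊗ₜ[ℂ] S A x) * Δ (εt z))
      = sw a (fun p z => sw p (fun x y => ((S A y * εt z) ⊗ₜ[ℂ] S A x) * Δ 1)) := by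
        refine sw_congr fun p z => ?_
        rw [comul_of_mem (targetMap_mem z), ← mul_assoc]
        simp only [sw_mul, Algebra.TensorProduct.tmul_mul_tmul, mul_one]
    _ = sw a (fun x p => sw p (fun y z => ((S A y * εt z) ⊗ₜ[ℂ] S A x) * Δ 1)) :=
        sw_coassoc a (fun x y z => ((S A y * εt z) ⊗ₜ[ℂ] S A x) * Δ 1)
    _ = sw a (fun x p => (S A p ⊗ₜ[ℂ] S A x) * Δ 1) :=
        sw_congr fun x p => sw_antipode_mul_target p (fun u => (u ⊗ₜ[ℂ] S A x) * Δ 1)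
    _ = sw a (fun x p => sw 1 (fun r s => (S A p * r) ⊗ₜ[ℂ] (S A x * s))) := by
        simp only [comul_eq_sw, mul_sw, Algebra.TensorProduct.tmul_mul_tmul]
    _ = sw a (fun x p => sw 1 (fun s r => (S A p * S A r) ⊗ₜ[ℂ] (S A x * S A s))) :=
        sw_congr fun x p =>
          (sw_one_antipode (fun s r => (S A p * r) ⊗ₜ[ℂ] (S A x * s))).symm
    _ = sw (1 * a) (fun x y => S A y ⊗ₜ[ℂ] S A x) := by
        rw [sw_mul_arg 1 a (fun x y => S A y ⊗ₜ[ℂ] S A x), sw_comm]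
        simp only [antipode_mul]
    _ = _ := by rw [one_mul]

/-- Uniqueness of convolution inverses: with F(a) = S(a₍₂₎) ⊗ S(a₍₁₎), the expression
F(a₍₁₎)Δ(a₍₂₎)Δ(S(a₍₃₎)) equals Δ(S(a)) when the first two factors are joined and F(a) when the last
two are. -/
lemma comul_antipode (a : A) : Δ (S A a) = sw a (fun x y => S A y ⊗ₜ[ℂ] S A x) := by
  calc Δ (S A a) = sw a (fun p z => Δ (εs p) * Δ (S A z)) := by
        rw [← sw_source_mul_antipode a (fun u => Δ u)]
        simp only [WeakCStarHopfAlgebra.comul_mul]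
    _ = sw a (fun p z => sw p (fun q y =>
          sw q (fun u v => S A v ⊗ₜ[ℂ] S A u) * Δ y * Δ (S A z))) := by
        simp only [← sw_mul, sw_antipode_tmul_mul_comul]
    _ = sw a (fun q p => sw p (fun y z =>
          sw q (fun u v => S A v ⊗ₜ[ℂ] S A u) * Δ y * Δ (S A z))) :=
        sw_coassoc a (fun q y z => sw q (fun u v => S A v ⊗ₜ[ℂ] S A u) * Δ y * Δ (S A z))
    _ = sw a (fun q p => sw q (fun u v => S A v ⊗ₜ[ℂ] S A u) * Δ (εt p)) := by
        refine sw_congr fun q p => ?_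
        rw [apply_targetMap p (fun u => sw q (fun u v => S A v ⊗ₜ[ℂ] S A u) * Δ u)]
        simp only [WeakCStarHopfAlgebra.comul_mul, mul_assoc]
    _ = _ := sw_antipode_tmul_mul_comul_target a

/-- `Δ(S(a)) = S(a₍₂₎) ⊗ S(a₍₁₎)`. -/
lemma sw_antipode_arg (a : A) (f : A → A → V)
    (h₁ : ∀ y, IsLin (fun x => f x y) := by fun_prop)
    (h₂ : ∀ x, IsLin (fun y => f x y) := by fun_prop) :
    sw (S A a) f = sw a (fun x y => f (S A y) (S A x)) := by
  rw [sw_eq_of_comul (comul_antipode a) f h₁ h₂, map_sw]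
  rfl

@[simp] lemma counit_antipode (a : A) : ε (S A a) = ε a := by
  rw [← sw_antipode_mul_target a (fun u => ε u)]
  simp only [counit_mul_target]
  rw [← apply_sourceMap a (fun u => ε u), counit_source]

lemma target_antipode (a : A) : εt (S A a) = S A (εs a) := by
  rw [apply_targetMap (S A a) (fun u => u), sw_antipode_arg a (fun x y => x * S A y),
    apply_sourceMap a (fun u => S A u)]
  simp only [antipode_mul]

lemma source_antipode (a : A) : εs (S A a) = S A (εt a) := by
  rw [apply_sourceMap (S A a) (fun u => u), sw_antipode_arg a (fun x y => S A x * y),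
    apply_targetMap a (fun u => S A u)]
  simp only [antipode_mul]

/-- The conjugate `a ↦ S(a⋆)⋆` of the antipode. -/
def starAntipode : A →ₗ[ℂ] A where
  toFun a := star (S A (star a))
  map_add' a b := by simp
  map_smul' c a := by simp

lemma starAntipode_apply (a : A) : starAntipode a = star (S A (star a)) := rfl

lemma star_sw (a : A) (f : A → A → A) : star (sw a f) = sw a (fun x y => star (f x y)) :=
  star_sum _ _

lemma star_source_star (a : A) : star (εs (star a)) = sw a (fun x y => y * starAntipode x) := by
  rw [apply_sourceMap (star a) (fun u => u), sw_star_arg a (fun x y => S A x * y), star_sw]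
  simp only [star_mul, star_star, starAntipode_apply]

lemma star_source_star_one (a : A) : star (εs (star a)) = sw 1 (fun x y => ε (y * a) • x) := by
  rw [← star_one A, sw_star_arg (1 : A) (fun x y => ε (y * a) • x),
    apply_sourceMap_one (star a) (fun u => u), star_sw]
  simp only [star_smul, ← counit_star, star_mul, star_star]

lemma star_target_star_one (a : A) : star (εt (star a)) = sw 1 (fun x y => ε (a * x) • y) := by
  rw [← star_one A, sw_star_arg (1 : A) (fun x y => ε (a * x) • y),
    apply_targetMap_one (star a) (fun u => u), star_sw]
  simp only [star_smul, ← counit_star, star_mul, star_star]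

/-- The conjugated counital map pairs Δ(1) with ε(·S(a)). Since S flips the legs of Δ(1) and
preserves ε, the argument S(a) becomes a. -/
lemma star_source_star_antipode (a : A) : star (εs (star (S A a))) = εs a := by
  calc star (εs (star (S A a))) = sw 1 (fun x y => ε (y * S A a) • x) := star_source_star_one _
    _ = sw 1 (fun x y => ε (S A x * S A a) • S A y) :=
        (sw_one_antipode (fun x y => ε (x * S A a) • y)).symm
    _ = sw 1 (fun x y => ε (a * (1 * x)) • S A y) := by
        simp only [← antipode_mul, counit_antipode, one_mul]
    _ = sw 1 (fun x y => ε (a * x) • εs y) :=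
        (sw_source_right 1 (fun x y => ε (a * x) • y)).symm
    _ = sw 1 (fun x y => sw 1 (fun r s => (ε (a * x) * ε (y * s)) • r)) :=
        sw_congr fun x y => by
          rw [apply_sourceMap_one y (fun u => u), smul_sw]
          simp only [mul_smul]
    _ = sw 1 (fun r s => ε (a * s) • r) := by
        rw [sw_comm]
        refine sw_congr fun r s => ?_
        rw [← sw_smul, ← counit_mul_mul, mul_one]
    _ = εs a := (apply_sourceMap_one a (fun u => u)).symm

lemma star_target_star_antipode (a : A) : star (εt (star (S A a))) = εt a := by
  calc star (εt (star (S A a))) = sw 1 (fun x y => ε (S A a * x) • y) := star_target_star_one _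
    _ = sw 1 (fun x y => ε (S A a * S A y) • S A x) :=
        (sw_one_antipode (fun x y => ε (S A a * y) • x)).symm
    _ = sw 1 (fun x y => ε (y * 1 * a) • S A x) := by
        simp only [← antipode_mul, counit_antipode, mul_one]
    _ = sw 1 (fun x y => ε (y * a) • εt x) :=
        (sw_target_left 1 (fun x y => ε (y * a) • x)).symm
    _ = sw 1 (fun x y => sw 1 (fun r s => (ε (r * x) * ε (y * a)) • s)) :=
        sw_congr fun x y => by
          rw [apply_targetMap_one x (fun u => u), smul_sw]
          simp only [smul_smul, mul_comm]
    _ = sw 1 (fun r s => ε (r * a) • s) := by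
        rw [sw_comm]
        refine sw_congr fun r s => ?_
        rw [← sw_smul, ← counit_mul_mul, mul_one]
    _ = εt a := (apply_targetMap_one a (fun u => u)).symm

/-- Write S̄ for the conjugate antipode. The expression a₍₁₎S(a₍₂₎)S̄(S(a₍₃₎)) equals S̄(S(a)) when
the first two factors are joined, and a₍₁₎εs(a₍₂₎) = a when the last two are. In finite dimension
this left inverse makes S bijective. -/
lemma starAntipode_antipode (a : A) : starAntipode (S A a) = a := by
  have h : ∀ b : A, starAntipode b = sw b (fun x y => star (εt (star y)) * starAntipode x) := by
    intro b
    rw [starAntipode_apply, ← sw_antipode_mul_target (star b) (fun u => u),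
      sw_star_arg b (fun x y => S A x * εt y), star_sw]
    simp only [star_mul, starAntipode_apply]
  -- The two conjugations cancel, so the composite is linear; the automatic linearity goals below
  -- take this from the context.
  have hlin : IsLin (fun y : A => star (εt (star y))) :=
    ⟨fun x y => by simp, fun c x => by simp⟩
  calc starAntipode (S A a)
      = sw a (fun x y => star (εt (star (S A x))) * starAntipode (S A y)) := by
        rw [h, sw_antipode_arg a (fun x y => star (εt (star y)) * starAntipode x)]
    _ = sw a (fun p z => sw p (fun x y => x * S A y * starAntipode (S A z))) :=
        sw_congr fun x y => by
          rw [star_target_star_antipode, apply_targetMap x (fun u => u * starAntipode (S A y))]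
    _ = sw a (fun x p => sw p (fun y z => x * S A y * starAntipode (S A z))) :=
        sw_coassoc a (fun x y z => x * S A y * starAntipode (S A z))
    _ = sw a (fun x p => x * εs p) := by
        refine sw_congr fun x p => ?_
        rw [← star_source_star_antipode, star_source_star,
          sw_antipode_arg p (fun u v => v * starAntipode u), mul_sw]
        simp only [mul_assoc]
    _ = a := sw_mul_source a (fun u => u)

variable (A) in
lemma antipode_injective : Function.Injective (S A) :=
  Function.LeftInverse.injective starAntipode_antipode

variable (A) in
lemma antipode_surjective : Function.Surjective (S A) :=
  LinearMap.injective_iff_surjective.1 (antipode_injective A)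

end Antipode

/-! ### Finite dimensional C*-algebras are semisimple. -/

section Semisimple

variable {A : Type*} [CStarAlgebra A]

/-- The C*-identity gives ‖a^(2ⁿ)‖ = ‖a‖^(2ⁿ) for self-adjoint a, and n ≤ 2ⁿ. -/
lemma IsSelfAdjoint.eq_zero_of_isNilpotent {a : A} (ha : IsSelfAdjoint a) (h : IsNilpotent a) :
    a = 0 := by
  obtain ⟨n, hn⟩ := h
  have h1 : a ^ 2 ^ n = 0 := by
    rw [← Nat.sub_add_cancel (Nat.lt_two_pow_self (n := n)).le, pow_add, hn, mul_zero]
  have h2 := ha.nnnorm_pow_two_pow n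
  rw [h1, nnnorm_zero] at h2
  exact nnnorm_eq_zero.1 (eq_zero_of_pow_eq_zero h2.symm)

variable (A) in
-- The Jacobson radical is nilpotent because A is Artinian. If a lies in it then so does a⋆a, which
-- is self-adjoint and nilpotent, hence zero.
lemma isSemisimpleRing_of_finiteDimensional [FiniteDimensional ℂ A] : IsSemisimpleRing A := by
  have : IsArtinianRing A := IsArtinianRing.of_finite ℂ A
  rw [IsArtinianRing.isSemisimpleRing_iff_jacobson, eq_bot_iff]
  intro a ha
  obtain ⟨n, hn⟩ := IsSemiprimaryRing.isNilpotent (R := A)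
  have h1 : star a * a ∈ Ring.jacobson A := Ideal.mul_mem_left _ _ ha
  have h2 : IsNilpotent (star a * a) := ⟨n, by
    have := Ideal.pow_mem_pow h1 n
    rwa [hn] at this⟩
  exact (CStarRing.star_mul_self_eq_zero_iff a).1
    (IsSelfAdjoint.eq_zero_of_isNilpotent (.star_mul_self a) h2)

end Semisimple

/-! ### Existence and uniqueness of the Haar integral, and how elements move between the legs of its
coproduct. -/

section Integrals

variable {A : Type*} [CStarAlgebra A] [FiniteDimensional ℂ A] [WeakCStarHopfAlgebra A]
  {V W : Type*} [AddCommGroup V] [Module ℂ V] [AddCommGroup W] [Module ℂ W]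

local notation "ε" => (counit : A →ₗ[ℂ] ℂ)
local notation "εt" => targetMap A
local notation "εs" => sourceMap A

variable (A) in
-- A Maschke argument: ker εt is a left ideal, so it has a complementary left ideal L. If l is the
-- component of 1 in L, then al - εt(a)l lies in L and is killed by εt, hence vanishes.
lemma exists_isLeftIntegral : ∃ l : A, IsLeftIntegral l ∧ εt l = 1 := by
  have := isSemisimpleRing_of_finiteDimensional A
  let K : Submodule A A :=
    { carrier := {a | εt a = 0}
      add_mem' := fun {a b} ha hb => by
        have ha : εt a = 0 := ha
        have hb : εt b = 0 := hb
        change εt (a + b) = 0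
        rw [map_add, ha, hb, add_zero]
      zero_mem' := map_zero _
      smul_mem' := fun c a ha => by
        have ha : εt a = 0 := ha
        change εt (c * a) = 0
        rw [← target_mul_target, ha, mul_zero, map_zero] }
  obtain ⟨L, hL⟩ := exists_isCompl K
  obtain ⟨k, hk, l, hl, hkl⟩ := Submodule.mem_sup.1 (hL.sup_eq_top.symm ▸ Submodule.mem_top :
    (1 : A) ∈ K ⊔ L)
  have hk : εt k = 0 := hk
  have hone : εt l = 1 := by
    have := congrArg εt hkl
    rwa [map_add, hk, zero_add, target_one] at this
  refine ⟨l, fun a => ?_, hone⟩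
  have hmem : ∀ b : A, b * l ∈ L := fun b => L.smul_mem b hl
  rw [← sub_eq_zero]
  refine Submodule.disjoint_def.1 hL.disjoint _ ?_ (L.sub_mem (hmem _) (hmem _))
  change εt _ = 0
  rw [map_sub, ← target_mul_target a l, target_target_mul, hone, mul_one, mul_one, sub_self]

lemma IsLeftIntegral.mul_right {l : A} (hl : IsLeftIntegral l) (b : A) : IsLeftIntegral (l * b) :=
  fun a => by rw [← mul_assoc, hl a, mul_assoc]

lemma IsRightIntegral.mul_left {r : A} (hr : IsRightIntegral r) (b : A) :
    IsRightIntegral (b * r) :=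
  fun a => by rw [mul_assoc, hr a, mul_assoc]

/-- The adjoint relation features a ↦ εt(a⋆)⋆ in place of εs. That map takes the same value at a and
at εs(a), because ε(ax) = ε(εs(a)x). -/
lemma IsLeftIntegral.star_isRightIntegral {l : A} (hl : IsLeftIntegral l) : IsRightIntegral (star l) := by
  have h : ∀ a : A, star l * a = star l * star (εt (star a)) := fun a => by
    have := congrArg star (hl (star a))
    rwa [star_mul, star_mul, star_star] at this
  intro a
  rw [h (εs a), h a, star_target_star_one, star_target_star_one]
  simp only [counit_source_mul]

lemma IsRightIntegral.star_isLeftIntegral {r : A} (hr : IsRightIntegral r) : IsLeftIntegral (star r) := by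
  have h : ∀ a : A, a * star r = star (εs (star a)) * star r := fun a => by
    have := congrArg star (hr (star a))
    rwa [star_mul, star_mul, star_star] at this
  intro a
  rw [h (εt a), h a, star_source_star_one, star_source_star_one]
  simp only [counit_mul_target]

/-- Expanding a = a₍₁₎εs(a₍₂₎) and moving εt(l) inside gives a₍₁₎εt(l)S(a₍₂₎)a₍₃₎. The integral
property turns the first three factors into εt(a₍₁₎)εt(l). It remains to commute εt(l) with
εt(a₍₁₎), which comes from S(A_R). -/
lemma IsLeftIntegral.target_central {l : A} (hl : IsLeftIntegral l) (a : A) :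
    a * εt l = εt l * a := by
  -- Compute εt(εs(c)l) twice: by placing εs(c) on the second leg of Δ(l), and by the integral
  -- property.
  have h1 : ∀ c : A, S A (εs c) * εt l = εt l * S A (εs c) := fun c => by
    have h : εt (εs c * l) = εt l * S A (εs c) := by
      rw [apply_targetMap (εs c * l) (fun u => u), sw_source_mul_arg c l (fun x y => x * S A y),
        apply_targetMap l (fun u => u * S A (εs c))]
      simp only [antipode_mul, mul_assoc]
    rw [← h, hl, target_target_mul, antipode_source]
  have h2 : ∀ b : A, sw b (fun x y => x * εt l * S A y) = εt b * εt l := fun b => by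
    rw [← target_target_mul, ← hl, ← target_mul_target, apply_targetMap (b * εt l) (fun u => u),
      sw_mul_target_arg b l (fun x y => x * S A y)]
  calc a * εt l = sw a (fun x y => x * εs y * εt l) :=
        (sw_mul_source a (fun u => u * εt l)).symm
    _ = sw a (fun x p => sw p (fun y z => x * εt l * S A y * z)) := by
        refine sw_congr fun x p => ?_
        rw [mul_assoc, source_mul_target, apply_sourceMap p (fun u => x * (εt l * u))]
        simp only [mul_assoc]
    _ = sw a (fun p z => sw p (fun x y => x * εt l * S A y * z)) :=
        (sw_coassoc a (fun x y z => x * εt l * S A y * z)).symm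
    _ = sw a (fun x y => εt x * εt l * y) := by simp only [← sw_mul, h2]
    _ = sw 1 (fun x y => S A x * εt l * (y * a)) := sw_target_left a (fun x y => x * εt l * y)
    _ = sw 1 (fun x y => S A (εs x) * εt l * (y * a)) :=
        (sw_one_source (fun x y => S A x * εt l * (y * a))).symm
    _ = sw 1 (fun x y => εt l * S A (εs x) * (y * a)) := by simp only [h1]
    _ = sw 1 (fun x y => εt l * S A x * (y * a)) :=
        sw_one_source (fun x y => εt l * S A x * (y * a))
    _ = sw a (fun x y => εt l * εt x * y) := (sw_target_left a (fun x y => εt l * x * y)).symm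
    _ = εt l * a := by
        simp only [mul_assoc]
        exact sw_target_mul a (fun u => εt l * u)

/-- Since h⋆ is a left integral, hh⋆ = εt(h)h⋆ = h⋆, so h is self-adjoint. Then εs(h)⋆ is a slice of
Δ(1) by ε(·h), which sees h only through εt(h) = 1. -/
lemma source_eq_one_of_target_eq_one {h : A} (hr : IsRightIntegral h)
    (h1 : εt h = 1) : εs h = 1 := by
  have h2 : h * star h = star h := by rw [hr.star_isLeftIntegral h, h1, one_mul]
  have h3 : star h = h := by
    have := congrArg Star.star h2
    rw [star_mul, star_star, h2] at this
    exact this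
  have h4 := star_source_star_one h
  rw [h3] at h4
  have h5 : star (εs h) = 1 := by
    rw [h4]
    calc sw (1 : A) (fun x y => ε (y * h) • x) = sw 1 (fun x y => ε (y * εt h) • x) := by
          simp only [counit_mul_target]
      _ = sw 1 (fun x y => ε y • x) := by simp only [h1, mul_one]
      _ = 1 := sw_counit 1 (fun u => u)
  rw [← star_star (εs h), h5, star_one]

/-- The element ll⋆ is a two-sided integral and lacks only normalization. Since εt(ll⋆) is central
and lies in A_L, it suffices to invert it among the central elements of A_L, which form the space N.
-/
lemma exists_isHaarIntegral_of_isLeftIntegral {l : A} (hl : IsLeftIntegral l) (h1 : εt l = 1) :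
    ∃ h : A, IsHaarIntegral h := by
  let N : Submodule ℂ A :=
    { carrier := {z | εt z = z ∧ ∀ a : A, a * z = z * a}
      add_mem' := fun {x y} hx hy =>
        ⟨by rw [map_add, hx.1, hy.1], fun a => by rw [mul_add, add_mul, hx.2, hy.2]⟩
      zero_mem' := ⟨map_zero _, fun a => by simp⟩
      smul_mem' := fun c x hx =>
        ⟨by rw [map_smul, hx.1], fun a => by rw [mul_smul_comm, smul_mul_assoc, hx.2]⟩ }
  have hll : IsLeftIntegral (l * star l) := hl.mul_right _
  have hlr : IsRightIntegral (l * star l) := hl.star_isRightIntegral.mul_left _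
  have hmul : ∀ z ∈ N, εt (l * star l) * z ∈ N := fun z hz => by
    refine ⟨by rw [target_target_mul, hz.1], fun a => ?_⟩
    rw [← mul_assoc, hll.target_central, mul_assoc, hz.2, mul_assoc]
  let T : N →ₗ[ℂ] N := (LinearMap.mulLeft ℂ (εt (l * star l))).restrict hmul
  -- By finite dimension, injectivity suffices for the inverse. If εt(ll⋆)z = 0, then (zl)(zl)⋆
  -- squares to 0, so zl = 0 by positivity, and z = zεt(l) = εt(zl) = 0.
  have hT : Function.Injective T := by
    refine (injective_iff_map_eq_zero T).2 fun ⟨z, hz⟩ h0 => ?_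
    have h0 : εt (l * star l) * z = 0 := congrArg Subtype.val h0
    have htz : ∀ b, εt (z * b) = z * εt b := fun b => by
      conv_lhs => rw [← hz.1, target_target_mul, hz.1]
    have hcz : ∀ a : A, star z * a = a * star z := fun a => by
      have := congrArg star (hz.2 (star a))
      rwa [star_mul, star_mul, star_star] at this
    have h2 : z * l * star (z * l) * (z * l * star (z * l)) = 0 := by
      have e : z * l * star (z * l) = l * star l * (z * star z) := by
        rw [star_mul, ← mul_assoc, mul_assoc z, ← hz.2, mul_assoc]
      have hc : z * star z * (l * star l) = l * star l * (z * star z) := by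
        rw [mul_assoc, hcz, ← mul_assoc, ← hz.2, mul_assoc]
      rw [e, mul_assoc, ← mul_assoc (z * star z), hc, mul_assoc (l * star l), ← mul_assoc, hll,
        mul_assoc (εt _), ← mul_assoc (l * star l), ← mul_assoc (l * star l), hz.2,
        ← mul_assoc (εt _), ← mul_assoc (εt _), ← mul_assoc (εt _), h0]
      simp only [zero_mul]
    have h3 : IsSelfAdjoint (z * l * star (z * l)) := .mul_star_self _
    have h4 : z * l * star (z * l) = 0 := by
      refine IsSelfAdjoint.eq_zero_of_isNilpotent h3 ⟨2, ?_⟩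
      rw [pow_two, h2]
    have h5 : z * l = 0 := (CStarRing.mul_star_self_eq_zero_iff _).1 h4
    refine Subtype.ext ?_
    change z = 0
    rw [← mul_one z, ← h1, ← htz, h5, map_zero]
  obtain ⟨⟨y, hy⟩, hxy⟩ := LinearMap.injective_iff_surjective.1 hT
    ⟨1, target_one, fun a => by rw [mul_one, one_mul]⟩
  have hxy : εt (l * star l) * y = 1 := congrArg Subtype.val hxy
  have hleft : IsLeftIntegral (y * (l * star l)) := fun a => by
    rw [← mul_assoc, hy.2, mul_assoc, hll, ← mul_assoc, ← hy.2, mul_assoc]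
  have hright : IsRightIntegral (y * (l * star l)) := hlr.mul_left _
  have hone : εt (y * (l * star l)) = 1 := by
    conv_lhs => rw [← hy.1, target_target_mul, hy.1, hll.target_central, hxy]
  exact ⟨_, hleft, hright, source_eq_one_of_target_eq_one hright hone, hone⟩

variable (A) in
lemma exists_isHaarIntegral : ∃ h : A, IsHaarIntegral h := by
  obtain ⟨l, hl, h1⟩ := exists_isLeftIntegral A
  exact exists_isHaarIntegral_of_isLeftIntegral hl h1

/-- Both integrals equal the product hh'. -/
lemma IsHaarIntegral.unique {h h' : A} (hh : IsHaarIntegral h) (hh' : IsHaarIntegral h') :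
    h = h' := by
  obtain ⟨-, hr, -, ht⟩ := hh
  obtain ⟨hl', -, hs', -⟩ := hh'
  have h1 := hl' h
  have h2 := hr h'
  rw [ht, one_mul] at h1
  rw [hs', mul_one] at h2
  exact h2.symm.trans h1

lemma IsHaarIntegral.antipode_eq {h : A} (hh : IsHaarIntegral h) : S A h = h := by
  refine IsHaarIntegral.unique ⟨fun a => ?_, fun a => ?_, ?_, ?_⟩ hh
  · obtain ⟨b, rfl⟩ := antipode_surjective A a
    rw [← antipode_mul, hh.2.1, antipode_mul, target_antipode]
  · obtain ⟨b, rfl⟩ := antipode_surjective A a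
    rw [← antipode_mul, hh.1, antipode_mul, source_antipode]
  · rw [source_antipode, hh.2.2.2, antipode_one]
  · rw [target_antipode, hh.2.2.1, antipode_one]

/-- `h₍₁₎ a ⊗ h₍₂₎ = h₍₁₎ ⊗ h₍₂₎ S(a)` for a right integral `h`. -/
lemma IsRightIntegral.sw_mul_left {h : A} (hh : IsRightIntegral h) (a : A) (f : A → A → V)
    (h₁ : ∀ y, IsLin (fun x => f x y) := by fun_prop)
    (h₂ : ∀ x, IsLin (fun y => f x y) := by fun_prop) :
    sw h (fun x y => f (x * a) y) = sw h (fun x y => f x (y * S A a)) := by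
  calc sw h (fun x y => f (x * a) y)
      = sw (h * 1) (fun x y => f (x * a) y) := by rw [mul_one]
    _ = sw h (fun x y => sw 1 (fun p q => f (x * (p * a)) (y * q))) := by
        rw [sw_mul_arg h 1 (fun x y => f (x * a) y)]
        simp only [mul_assoc]
    _ = sw h (fun x y => sw a (fun p z => f (x * p) (y * εt z))) :=
        sw_congr fun x y => (sw_target_right a (fun p q => f (x * p) (y * q))).symm
    _ = sw h (fun x y => sw a (fun p t => sw t (fun q r => f (x * p) (y * q * S A r)))) := by
        refine sw_congr fun x y => sw_congr fun p t => ?_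
        rw [apply_targetMap t (fun u => f (x * p) (y * u))]
        simp only [mul_assoc]
    _ = sw h (fun x y => sw a (fun t r => sw t (fun p q => f (x * p) (y * q * S A r)))) :=
        sw_congr fun x y => (sw_coassoc a (fun p q r => f (x * p) (y * q * S A r))).symm
    _ = sw a (fun t r => sw (h * t) (fun x y => f x (y * S A r))) := by
        rw [sw_comm]
        exact sw_congr fun t r => (sw_mul_arg h t (fun x y => f x (y * S A r))).symm
    _ = sw a (fun t r => sw h (fun x y => f x (y * (εs t * S A r)))) := by
        refine sw_congr fun t r => ?_
        rw [hh, sw_mul_source_arg h t (fun x y => f x (y * S A r))]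
        simp only [mul_assoc]
    _ = sw h (fun x y => f x (y * S A a)) := by
        rw [sw_comm]
        exact sw_congr fun x y => sw_source_mul_antipode a (fun u => f x (y * u))

/-- `h₍₁₎ ⊗ a h₍₂₎ = S(a) h₍₁₎ ⊗ h₍₂₎` for a left integral `h`. -/
lemma IsLeftIntegral.sw_mul_right {h : A} (hh : IsLeftIntegral h) (a : A) (f : A → A → V)
    (h₁ : ∀ y, IsLin (fun x => f x y) := by fun_prop)
    (h₂ : ∀ x, IsLin (fun y => f x y) := by fun_prop) :
    sw h (fun x y => f x (a * y)) = sw h (fun x y => f (S A a * x) y) := by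
  calc sw h (fun x y => f x (a * y))
      = sw (1 * h) (fun x y => f x (a * y)) := by rw [one_mul]
    _ = sw h (fun x y => sw 1 (fun p q => f (p * x) (a * q * y))) := by
        rw [sw_mul_arg 1 h (fun x y => f x (a * y)), sw_comm]
        simp only [mul_assoc]
    _ = sw h (fun x y => sw a (fun z q => f (εs z * x) (q * y))) :=
        sw_congr fun x y => (sw_source_left a (fun p q => f (p * x) (q * y))).symm
    _ = sw h (fun x y => sw a (fun t r => sw t (fun p q => f (S A p * (q * x)) (r * y)))) := by
        refine sw_congr fun x y => sw_congr fun t r => ?_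
        rw [apply_sourceMap t (fun u => f (u * x) (r * y))]
        simp only [mul_assoc]
    _ = sw h (fun x y => sw a (fun p t => sw t (fun q r => f (S A p * (q * x)) (r * y)))) :=
        sw_congr fun x y => sw_coassoc a (fun p q r => f (S A p * (q * x)) (r * y))
    _ = sw a (fun p t => sw (t * h) (fun x y => f (S A p * x) y)) := by
        rw [sw_comm]
        refine sw_congr fun p t => ?_
        rw [sw_comm, sw_mul_arg t h (fun x y => f (S A p * x) y)]
    _ = sw a (fun p t => sw h (fun x y => f (S A p * εt t * x) y)) := by
        refine sw_congr fun p t => ?_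
        rw [hh, sw_target_mul_arg t h (fun x y => f (S A p * x) y)]
        simp only [mul_assoc]
    _ = sw h (fun x y => f (S A a * x) y) := by
        rw [sw_comm]
        exact sw_congr fun x y => sw_antipode_mul_target a (fun u => f (u * x) y)

/-- `S(h₍₁₎) ⊗ S(h₍₂₎) = h₍₂₎ ⊗ h₍₁₎` for the Haar integral `h`. -/
lemma IsHaarIntegral.sw_antipode {h : A} (hh : IsHaarIntegral h) (f : A → A → V)
    (h₁ : ∀ y, IsLin (fun x => f x y) := by fun_prop)
    (h₂ : ∀ x, IsLin (fun y => f x y) := by fun_prop) :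
    sw h (fun x y => f (S A x) (S A y)) = sw h (fun x y => f y x) := by
  conv_rhs => rw [← hh.antipode_eq]
  exact (sw_antipode_arg h (fun x y => f y x)).symm

/-! ### The dual integral -/

lemma hit_eq (φ : Module.Dual ℂ A) (a : A) : hit φ a = sw a (fun x y => φ y • x) :=
  apply_comul ((TensorProduct.rid ℂ A).toLinearMap ∘ₗ φ.lTensor A) a

lemma apply_hit (φ : Module.Dual ℂ A) (a : A) (g : A → V) (hg : IsLin g := by fun_prop) :
    g (hit φ a) = sw a (fun x y => φ y • g x) := by
  rw [hit_eq, hg.map_sw]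
  exact sw_congr fun x y => hg.map_smul _ _

lemma conv_eq {M : Type*} [Ring M] [Algebra ℂ M] (f g : A →ₗ[ℂ] M) (a : A) :
    conv f g a = sw a (fun x y => f x * g y) :=
  apply_comul (LinearMap.mul' ℂ M ∘ₗ TensorProduct.map f g) a

lemma dualTargetMap_apply (φ : Module.Dual ℂ A) (a : A) : dualTargetMap φ a = φ (εt a) := by
  have key : ∀ t : Module.Dual ℂ A ⊗[ℂ] Module.Dual ℂ A,
      TensorProduct.lift conv (dualAntipode.lTensor _ t) a =
        sw a (fun x y => TensorProduct.dualDistrib ℂ A A t (x ⊗ₜ[ℂ] S A y)) := by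
    intro t
    induction t with
    | zero => simp [sw]
    | add t t' ht ht' => simp only [map_add, LinearMap.add_apply, ht, ht', sw,
        Finset.sum_add_distrib]
    | tmul φ ψ =>
      rw [LinearMap.lTensor_tmul, TensorProduct.lift.tmul, conv_eq]
      rfl
  have h1 : TensorProduct.dualDistrib ℂ A A (dualComul φ) = φ ∘ₗ LinearMap.mul' ℂ A :=
    (TensorProduct.dualDistribEquiv ℂ A A).apply_symm_apply _
  rw [dualTargetMap, key, h1, apply_targetMap a (fun u => φ u)]
  rfl

/-- The product φ·lam evaluates at a to φ(lam ⇀ a), and the counital map of the dual is the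
transpose of εt. Functionals separate points, so the condition is that lam ⇀ a always lies in A_L.
-/
lemma isDualLeftIntegral_iff (lam : Module.Dual ℂ A) :
    IsDualLeftIntegral lam ↔ ∀ a, εt (hit lam a) = hit lam a := by
  have h1 : ∀ (φ : Module.Dual ℂ A) (a : A), conv φ lam a = φ (hit lam a) := fun φ a => by
    rw [conv_eq, apply_hit lam a (fun u => φ u)]
    exact sw_congr fun x y => by rw [smul_eq_mul, mul_comm]
  have h2 : ∀ (φ : Module.Dual ℂ A) (a : A), conv (dualTargetMap φ) lam a = φ (εt (hit lam a)) :=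
    fun φ a => by rw [h1, dualTargetMap_apply]
  constructor
  · intro h a
    refine (Module.forall_dual_apply_eq_zero_iff ℂ _).1 (fun φ => ?_) |> sub_eq_zero.1
    rw [map_sub, ← h1, ← h2, h φ, sub_self]
  · intro h φ
    ext a
    rw [h1, h2, h]

end Integrals

/-! ### Construction of the dual integral and the dual basis identities. -/

section DualIntegral

variable {A : Type*} [CStarAlgebra A] [FiniteDimensional ℂ A] [WeakCStarHopfAlgebra A]
  {V W : Type*} [AddCommGroup V] [Module ℂ V] [AddCommGroup W] [Module ℂ W]

local notation "ε" => (counit : A →ₗ[ℂ] ℂ)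
local notation "εt" => targetMap A
local notation "εs" => sourceMap A

lemma mem_leftSub_iff {b : A} : b ∈ leftSub A ↔ εt b = b := by
  refine ⟨?_, fun h => h ▸ targetMap_mem b⟩
  rintro ⟨φ, rfl⟩
  have h : TensorProduct.lid ℂ A (φ.rTensor A (comul (1 : A))) = sw 1 (fun x y => φ x • y) :=
    apply_comul ((TensorProduct.lid ℂ A).toLinearMap ∘ₗ φ.rTensor A) 1
  change εt (TensorProduct.lid ℂ A (φ.rTensor A (comul (1 : A)))) =
    TensorProduct.lid ℂ A (φ.rTensor A (comul (1 : A)))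
  rw [h, map_sw]
  simp only [map_smul]
  exact sw_one_target (fun x y => φ x • y)

lemma mem_rightSub_iff {b : A} : b ∈ rightSub A ↔ εs b = b := by
  constructor
  · rintro ⟨φ, rfl⟩
    have h : TensorProduct.rid ℂ A (φ.lTensor A (comul (1 : A))) = sw 1 (fun x y => φ y • x) :=
      apply_comul ((TensorProduct.rid ℂ A).toLinearMap ∘ₗ φ.lTensor A) 1
    change εs (TensorProduct.rid ℂ A (φ.lTensor A (comul (1 : A)))) =
      TensorProduct.rid ℂ A (φ.lTensor A (comul (1 : A)))
    rw [h, map_sw]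
    simp only [map_smul]
    exact sw_one_source (fun x y => φ y • x)
  · intro h
    refine ⟨counit ∘ₗ LinearMap.mulLeft ℂ b, ?_⟩
    exact (WeakCStarHopfAlgebra.antipode_mul b).symm.trans h

lemma trace_eq_sum_coord (f : A →ₗ[ℂ] A) :
    LinearMap.trace ℂ A f = ∑ i, (Module.finBasis ℂ A).coord i (f (Module.finBasis ℂ A i)) := by
  rw [LinearMap.trace_eq_matrix_trace ℂ (Module.finBasis ℂ A), Matrix.trace]
  exact Finset.sum_congr rfl fun i _ => by
    rw [Matrix.diag_apply, LinearMap.toMatrix_apply]; rfl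

variable (A) in
/-- The functional `a ↦ Tr(b ↦ a S²(b))`. -/
def traceIntegral : Module.Dual ℂ A :=
  ∑ i, (Module.finBasis ℂ A).coord i ∘ₗ
    LinearMap.mulRight ℂ (S A (S A (Module.finBasis ℂ A i)))

lemma traceIntegral_apply (a : A) : traceIntegral A a = ∑ i, (Module.finBasis ℂ A).coord i
    (a * S A (S A (Module.finBasis ℂ A i))) := by
  simp [traceIntegral]

lemma hit_traceIntegral (a : A) : hit (traceIntegral A) a = ∑ i, sw a (fun x y =>
    (Module.finBasis ℂ A).coord i (y * S A (S A (Module.finBasis ℂ A i))) • x) := by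
  simp only [hit_eq, traceIntegral_apply, Finset.sum_smul]
  exact Finset.sum_comm

/-- The right integral property moves S²(b) from the second leg of Δ(h) to S(b) on the first.
Summing over a basis, the trace then reassembles h₍₁₎S(h₍₂₎) = 1. -/
lemma IsHaarIntegral.hit_traceIntegral {h : A} (hh : IsHaarIntegral h) :
    hit (traceIntegral A) h = 1 := by
  calc hit (traceIntegral A) h
      = ∑ i, sw h (fun x y => (Module.finBasis ℂ A).coord i
          (y * S A (S A (Module.finBasis ℂ A i))) • x) := WeakHopf.hit_traceIntegral h
    _ = ∑ i, sw h (fun x y => (Module.finBasis ℂ A).coord i y •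
          (x * S A (Module.finBasis ℂ A i))) :=
        Finset.sum_congr rfl fun i _ => (hh.2.1.sw_mul_left (S A (Module.finBasis ℂ A i))
          (fun x y => (Module.finBasis ℂ A).coord i y • x)).symm
    _ = sw h (fun x y => ∑ i, (Module.finBasis ℂ A).coord i y •
          (x * S A (Module.finBasis ℂ A i))) := Finset.sum_comm
    _ = sw h (fun x y => x * S A y) := by
        refine sw_congr fun x y => ?_
        conv_rhs => rw [← (Module.finBasis ℂ A).sum_repr y]
        simp only [map_sum, map_smul, Finset.mul_sum, mul_smul_comm, Module.Basis.coord_apply]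
    _ = 1 := by rw [← apply_targetMap h (fun u => u), hh.2.2.2]

/-- `a₍₁₎ ⊗ a₍₂₎ S²(b)` in terms of the coproduct of `a S²(b₍₂₎)`. -/
lemma sw_mul_antipode_antipode (a b : A) (f : A → A → V)
    (h₁ : ∀ y, IsLin (fun x => f x y) := by fun_prop)
    (h₂ : ∀ x, IsLin (fun y => f x y) := by fun_prop) :
    sw a (fun x y => f x (y * S A (S A b))) =
      sw b (fun p q => sw (a * S A (S A q)) (fun u v => f (u * S A p) v)) := by
  symm
  calc sw b (fun p q => sw (a * S A (S A q)) (fun u v => f (u * S A p) v))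
      = sw b (fun p t => sw t (fun q r => sw a (fun x y =>
          f (x * S A (p * S A q)) (y * S A (S A r))))) := by
        refine sw_congr fun p t => ?_
        rw [sw_mul_arg a (S A (S A t)) (fun u v => f (u * S A p) v), sw_comm,
          sw_antipode_arg (S A t) (fun q r => sw a (fun x y => f (x * q * S A p) (y * r))),
          sw_antipode_arg t (fun r q => sw a (fun x y => f (x * S A q * S A p) (y * S A r)))]
        simp only [antipode_mul, mul_assoc]
    _ = sw b (fun t r => sw t (fun p q => sw a (fun x y =>
          f (x * S A (p * S A q)) (y * S A (S A r))))) :=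
        (sw_coassoc b (fun p q r => sw a (fun x y =>
          f (x * S A (p * S A q)) (y * S A (S A r))))).symm
    _ = sw b (fun t r => sw a (fun x y => f (x * S A (εt t)) (y * S A (S A r)))) :=
        sw_congr fun t r => (apply_targetMap t (fun u => sw a (fun x y =>
          f (x * S A u) (y * S A (S A r))))).symm
    _ = sw 1 (fun p q => sw a (fun x y => f (x * S A (S A p)) (y * S A (S A (q * b))))) :=
        sw_target_left b (fun p q => sw a (fun x y => f (x * S A p) (y * S A (S A q))))
    _ = sw 1 (fun p q => sw a (fun x y => f (x * S A (S A p)) (y * S A (S A q) *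
          S A (S A b)))) := by simp only [antipode_mul, mul_assoc]
    _ = sw 1 (fun p q => sw a (fun x y => f (x * S A q) (y * S A p * S A (S A b)))) :=
        sw_one_antipode (fun p q => sw a (fun x y => f (x * S A p) (y * S A q * S A (S A b))))
    _ = sw 1 (fun p q => sw a (fun x y => f (x * p) (y * q * S A (S A b)))) :=
        sw_one_antipode (fun p q => sw a (fun x y => f (x * q) (y * p * S A (S A b))))
    _ = sw (a * 1) (fun x y => f x (y * S A (S A b))) := by
        rw [sw_comm, sw_mul_arg a 1 (fun x y => f x (y * S A (S A b)))]
    _ = _ := by rw [mul_one]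

/-- Cyclicity of the trace in Sweedler form. -/
lemma sum_coord_sw_cyclic (Y : A →ₗ[ℂ] A) (g : A → A → V) :
    ∑ i, sw (Module.finBasis ℂ A i) (fun p q => sw (Y q) (fun u v =>
        (Module.finBasis ℂ A).coord i v • g u p)) =
      ∑ i, sw (Module.finBasis ℂ A i) (fun p q => sw q (fun r s =>
        (Module.finBasis ℂ A).coord i (Y s) • g p r)) := by
  -- This is Tr(XY) = Tr(YX) with X the k-th slice of Δ; no formula for Y is needed.
  have key : ∀ j k, ∑ i, (Module.finBasis ℂ A).coord i
        (slice k (Y (slice j (Module.finBasis ℂ A i)))) =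
      ∑ i, (Module.finBasis ℂ A).coord i (Y (slice j (slice k (Module.finBasis ℂ A i)))) := by
    intro j k
    have := LinearMap.trace_mul_comm ℂ (slice (A := A) k) (Y * slice j)
    rwa [trace_eq_sum_coord, trace_eq_sum_coord] at this
  simp only [sw]
  rw [Finset.sum_comm]
  conv_rhs => rw [Finset.sum_comm]
  have h1 : ∀ j, (∑ i, ∑ k, (Module.finBasis ℂ A).coord i
      (slice k (Y (slice j (Module.finBasis ℂ A i)))) •
        g (Module.finBasis ℂ A k) (Module.finBasis ℂ A j)) =
      ∑ k, ∑ i, (Module.finBasis ℂ A).coord i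
      (Y (slice j (slice k (Module.finBasis ℂ A i)))) •
        g (Module.finBasis ℂ A k) (Module.finBasis ℂ A j) := by
    intro j
    rw [Finset.sum_comm]
    exact Finset.sum_congr rfl fun k _ => by rw [← Finset.sum_smul, key, Finset.sum_smul]
  rw [Finset.sum_congr rfl fun j _ => h1 j, Finset.sum_comm]
  exact Finset.sum_congr rfl fun k _ => Finset.sum_comm

variable (A) in
-- After `sw_mul_antipode_antipode` and cyclicity of the trace, the first leg appears only as p S(r)
-- for adjacent legs p, r of a basis element. It is therefore a value of εt, and the result lies in
-- A_L.
lemma isDualLeftIntegral_traceIntegral : IsDualLeftIntegral (traceIntegral A) := by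
  rw [isDualLeftIntegral_iff]
  intro a
  have h : hit (traceIntegral A) a = ∑ i, sw (Module.finBasis ℂ A i) (fun p q =>
      (Module.finBasis ℂ A).coord i (a * S A (S A q)) • εt p) := by
    calc hit (traceIntegral A) a
        = ∑ i, sw a (fun x y => (Module.finBasis ℂ A).coord i
            (y * S A (S A (Module.finBasis ℂ A i))) • x) := hit_traceIntegral a
      _ = ∑ i, sw (Module.finBasis ℂ A i) (fun p q => sw (a * S A (S A q)) (fun u v =>
            (Module.finBasis ℂ A).coord i v • (u * S A p))) :=
          Finset.sum_congr rfl fun i _ => sw_mul_antipode_antipode a (Module.finBasis ℂ A i)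
            (fun x y => (Module.finBasis ℂ A).coord i y • x)
      _ = ∑ i, sw (Module.finBasis ℂ A i) (fun p q => sw q (fun r s =>
            (Module.finBasis ℂ A).coord i (a * S A (S A s)) • (p * S A r))) :=
          sum_coord_sw_cyclic (LinearMap.mulLeft ℂ a ∘ₗ S A ∘ₗ S A) (fun u p => u * S A p)
      _ = _ := by
          refine Finset.sum_congr rfl fun i _ => ?_
          rw [← sw_coassoc (Module.finBasis ℂ A i) (fun p r s =>
            (Module.finBasis ℂ A).coord i (a * S A (S A s)) • (p * S A r))]
          exact sw_congr fun t s => (apply_targetMap t (fun u =>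
            (Module.finBasis ℂ A).coord i (a * S A (S A s)) • u)).symm
  rw [h]
  simp only [map_sum, map_sw, map_smul, target_target]

lemma exists_isIntegralDualTo {h : A} (hh : IsHaarIntegral h) :
    ∃ lam : Module.Dual ℂ A, IsIntegralDualTo lam h :=
  ⟨traceIntegral A, isDualLeftIntegral_traceIntegral A, hh.hit_traceIntegral⟩

/-- The dual and A have the same dimension, so surjectivity is enough. With τ the trace functional,
τ(a·) is sent to h₍₁₎τ(ah₍₂₎) = S(a)h₍₁₎τ(h₍₂₎) = S(a), and S is onto. -/
lemma hit_injective {h : A} (hh : IsHaarIntegral h) :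
    Function.Injective (fun φ : Module.Dual ℂ A => hit φ h) := by
  let F : Module.Dual ℂ A →ₗ[ℂ] A :=
    { toFun := fun φ => hit φ h
      map_add' := fun φ ψ => by
        simp only [hit_eq, LinearMap.add_apply, add_smul, sw, Finset.sum_add_distrib]
      map_smul' := fun c φ => by
        simp only [hit_eq, LinearMap.smul_apply, smul_assoc, sw, Finset.smul_sum,
          RingHom.id_apply] }
  refine (LinearMap.injective_iff_surjective_of_finrank_eq_finrank (f := F)
    Subspace.dual_finrank_eq).2 fun c => ?_
  obtain ⟨a, rfl⟩ := antipode_surjective A c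
  refine ⟨traceIntegral A ∘ₗ LinearMap.mulLeft ℂ a, ?_⟩
  change hit _ h = _
  rw [hit_eq]
  refine (hh.1.sw_mul_right a (fun x y => traceIntegral A y • x)).trans ?_
  simp only [← mul_smul_comm]
  rw [← mul_sw, ← hit_eq, hh.hit_traceIntegral, mul_one]

lemma apply_eq_counit_hit (φ : Module.Dual ℂ A) (a : A) : φ a = ε (hit φ a) := by
  rw [apply_hit φ a (fun u => ε u)]
  simp only [smul_eq_mul, mul_comm (φ _)]
  exact (counit_sw a φ).symm

section

variable {h : A} {lam : Module.Dual ℂ A}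

/-- For b in A_L, S(b) lies in A_R and multiplies only the second leg of Δ(h). The right integral
property carries it to b on the first leg, so lam ⇀ hS(b) = b; then apply ε. -/
lemma IsIntegralDualTo.apply_mul_antipode_target (hh : IsHaarIntegral h)
    (hlam : IsIntegralDualTo lam h) (a : A) : lam (h * S A (εt a)) = ε a := by
  have h1 : hit lam (h * S A (εt a)) = εt a := by
    calc hit lam (h * S A (εt a)) = sw h (fun x y => lam (y * S A (εt a)) • x) := by
          rw [hit_eq, ← source_antipode, sw_mul_source_arg h (S A a) (fun x y => lam y • x)]
      _ = sw h (fun x y => lam y • (x * εt a)) :=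
          (hh.2.1.sw_mul_left (εt a) (fun x y => lam y • x)).symm
      _ = εt a := by
          rw [← apply_hit lam h (fun u => u * εt a), hlam.2, one_mul]
  rw [apply_eq_counit_hit, h1, counit_target]

/-- `S(h₍₁₎) (lam ⇀ h₍₂₎ a) = a`. -/
lemma IsIntegralDualTo.sw_antipode_mul_hit (hh : IsHaarIntegral h)
    (hlam : IsIntegralDualTo lam h) (a : A) :
    sw h (fun x y => S A x * hit lam (y * a)) = a := by
  calc sw h (fun x y => S A x * hit lam (y * a))
      = sw h (fun x t => sw t (fun p q => sw a (fun r s => lam (q * s) • (S A x * p * r)))) := by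
        refine sw_congr fun x t => ?_
        rw [apply_hit lam (t * a) (fun u => S A x * u),
          sw_mul_arg t a (fun u v => lam v • (S A x * u))]
        simp only [mul_assoc]
    _ = sw h (fun t q => sw t (fun x p => sw a (fun r s => lam (q * s) • (S A x * p * r)))) :=
        (sw_coassoc h (fun x p q => sw a (fun r s => lam (q * s) • (S A x * p * r)))).symm
    _ = sw h (fun t q => sw a (fun r s => lam (q * s) • (εs t * r))) :=
        sw_congr fun t q => (apply_sourceMap t (fun u => sw a (fun r s =>
          lam (q * s) • (u * r)))).symm
    -- Here h is restored whole, so its right integral property applies to the remaining factor.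
    _ = sw 1 (fun p q => sw a (fun r s => lam (h * q * s) • (p * r))) :=
        sw_source_left h (fun p q => sw a (fun r s => lam (q * s) • (p * r)))
    _ = sw (1 * a) (fun r s => lam (h * s) • r) := by
        rw [sw_mul_arg 1 a (fun r s => lam (h * s) • r)]
        simp only [mul_assoc]
    _ = sw a (fun r s => lam (h * εs s) • r) := by
        rw [one_mul]
        exact sw_congr fun r s => by rw [hh.2.1]
    _ = sw 1 (fun p q => lam (h * S A q) • (a * p)) :=
        sw_source_right a (fun r s => lam (h * s) • r)
    _ = sw 1 (fun p q => lam (h * S A (εt q)) • (a * p)) :=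
        (sw_one_target (fun p q => lam (h * S A q) • (a * p))).symm
    _ = sw 1 (fun p q => ε q • (a * p)) := by simp only [hlam.apply_mul_antipode_target hh]
    _ = a := (sw_counit 1 (fun u => a * u)).trans (mul_one a)

/-- For a = 1 this is lam ⇀ h = 1 after applying S, which flips the legs of Δ(h). A general a is
S(b), and S(b)S(h₍₁₎) = S(h₍₁₎b) lets the right integral property carry it to the second leg. -/
lemma IsIntegralDualTo.sw_apply_mul_antipode (hh : IsHaarIntegral h)
    (hlam : IsIntegralDualTo lam h) (a : A) (g : A → V) (hg : IsLin g := by fun_prop) :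
    sw h (fun x y => lam (a * S A x) • g y) = g a := by
  have h1 : sw h (fun x y => lam (S A x) • y) = 1 := by
    refine antipode_injective A ?_
    rw [map_sw, antipode_one, ← hlam.2, hit_eq]
    simp only [map_smul]
    exact hh.sw_antipode (fun x y => lam x • y)
  obtain ⟨b, rfl⟩ := antipode_surjective A a
  simp only [← antipode_mul]
  rw [hh.2.1.sw_mul_left b (fun x y => lam (S A x) • g y)]
  calc sw h (fun x y => lam (S A x) • g (y * S A b))
      = g (sw h (fun x y => lam (S A x) • y) * S A b) := by
        rw [IsLin.map_sw (g := fun u => g (u * S A b)) (by fun_prop)]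
        refine sw_congr fun x y => ?_
        rw [smul_mul_assoc, hg.map_smul]
    _ = _ := by rw [h1, one_mul]

/-- The left integrals of the dual are the functionals `lam(· y)` with `y ∈ A_R`. -/
lemma IsIntegralDualTo.isDualLeftIntegral_iff_exists (hh : IsHaarIntegral h)
    (hlam : IsIntegralDualTo lam h) (mu : Module.Dual ℂ A) :
    IsDualLeftIntegral mu ↔ ∃ y ∈ rightSub A, mu = lam ∘ₗ LinearMap.mulRight ℂ y := by
  constructor
  · intro hmu
    -- Applying mu to the identity λ(aS(h₍₁₎))h₍₂₎ = a forces this choice of y. It lies in A_R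
    -- because mu ⇀ h lies in A_L.
    refine ⟨S A (hit mu h), ?_, ?_⟩
    · rw [mem_rightSub_iff, source_antipode, (isDualLeftIntegral_iff mu).1 hmu]
    · ext a
      rw [LinearMap.comp_apply, LinearMap.mulRight_apply,
        apply_hit mu h (fun u => lam (a * S A u)),
        ← hlam.sw_apply_mul_antipode hh a mu]
      exact sw_congr fun x y => by rw [smul_eq_mul, smul_eq_mul, mul_comm]
  · rintro ⟨y, hy, rfl⟩
    rw [isDualLeftIntegral_iff]
    rw [mem_rightSub_iff] at hy
    intro a
    have h1 : hit (lam ∘ₗ LinearMap.mulRight ℂ y) a = hit lam (a * y) := by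
      rw [hit_eq, hit_eq, ← hy, sw_mul_source_arg a y (fun u v => lam v • u)]
      rfl
    rw [h1, (isDualLeftIntegral_iff lam).1 hlam.1]

end

end DualIntegral

/-- Brings the two middle legs of a fourfold coproduct together, so that S(a₍₂₎)a₍₃₎ can be
collapsed to εs. -/
lemma sw_regroup {A : Type*} [CStarAlgebra A] [FiniteDimensional ℂ A] [WeakCStarHopfAlgebra A]
    {V : Type*} [AddCommGroup V] [Module ℂ V] (a : A) (f : A → A → A → A → V)
    (h₁ : ∀ y z t, IsLin (fun x => f x y z t) := by fun_prop)
    (h₂ : ∀ x z t, IsLin (fun y => f x y z t) := by fun_prop)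
    (h₃ : ∀ x y t, IsLin (fun z => f x y z t) := by fun_prop)
    (h₄ : ∀ x y z, IsLin (fun t => f x y z t) := by fun_prop) :
    sw a (fun p q => sw p (fun x y => sw q (fun z t => f x y z t))) =
      sw a (fun x p => sw p (fun q t => sw q (fun y z => f x y z t))) :=
  (sw_coassoc a (fun x y q => sw q (fun z t => f x y z t))).trans
    (sw_congr fun x p => (sw_coassoc p (fun y z t => f x y z t)).symm)

/-! ### The relative commutant, the inner implementers and outerness. -/

namespace ModuleAlgebra

variable {A : Type*} [CStarAlgebra A] [FiniteDimensional ℂ A] [WeakCStarHopfAlgebra A]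
  {M : Type*} [Ring M] [StarRing M] [Algebra ℂ M] (α : ModuleAlgebra A M)
  {V : Type*} [AddCommGroup V] [Module ℂ V]

local notation "ε" => (counit : A →ₗ[ℂ] ℂ)
local notation "εt" => targetMap A
local notation "εs" => sourceMap A

instance : IsScalarTower ℂ α.CrossedProduct α.CrossedProduct := ⟨α.smul_mul_cros⟩

instance : SMulCommClass ℂ α.CrossedProduct α.CrossedProduct := ⟨fun c x y => by
  obtain ⟨x, rfl⟩ := α.proj_surjective x
  obtain ⟨y, rfl⟩ := α.proj_surjective y
  change c • α.projC (α.mulMap x y) = α.projC (α.mulMap x (c • y))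
  simp⟩

@[fun_prop]
lemma isLin_cros_left {f : V → M} (a : A) (hf : IsLin f) : IsLin (fun x => α.cros (f x) a) :=
  ⟨fun x y => by
      change α.projC _ = α.projC _ + α.projC _
      rw [hf.map_add, TensorProduct.add_tmul, map_add],
    fun c x => by
      change α.projC _ = c • α.projC _
      rw [hf.map_smul, ← TensorProduct.smul_tmul', map_smul]⟩

@[fun_prop]
lemma isLin_cros_right {f : V → A} (m : M) (hf : IsLin f) : IsLin (fun x => α.cros m (f x)) :=
  ⟨fun x y => by
      change α.projC _ = α.projC _ + α.projC _
      rw [hf.map_add, TensorProduct.tmul_add, map_add],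
    fun c x => by
      change α.projC _ = c • α.projC _
      rw [hf.map_smul, TensorProduct.tmul_smul, map_smul]⟩

@[fun_prop]
lemma isLin_condExp (φ : Module.Dual ℂ A) {f : V → α.CrossedProduct} (hf : IsLin f) :
    IsLin (fun x => α.condExp φ (f x)) :=
  ⟨fun x y => by rw [hf.map_add, map_add], fun c x => by rw [hf.map_smul, condExp_smul]⟩

lemma crossedProduct_induction {P : α.CrossedProduct → Prop} (x : α.CrossedProduct)
    (hadd : ∀ x y, P x → P y → P (x + y)) (hcros : ∀ m a, P (α.cros m a)) : P x := by
  obtain ⟨x, rfl⟩ := α.proj_surjective x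
  induction x with
  | zero =>
    have := hcros 0 0
    rwa [cros, TensorProduct.zero_tmul] at this
  | add x y hx hy => rw [map_add]; exact hadd _ _ hx hy
  | tmul m a => exact hcros m a

lemma act_mul_sw (a : A) (m n : M) :
    α.act a (m * n) = sw a (fun x y => α.act x m * α.act y n) :=
  (α.act_mul a m n).trans
    (apply_comul (LinearMap.mul' ℂ M ∘ₗ TensorProduct.map (α.act.flip m) (α.act.flip n)) a)

lemma cros_mul_cros_sw (m n : M) (a b : A) :
    α.cros m a * α.cros n b = sw a (fun x y => α.cros (m * α.act x n) (y * b)) := by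
  rw [cros_mul_cros, comul_eq_sw]
  simp only [sw, map_sum, Finset.mul_sum, Finset.sum_mul, LinearMap.rTensor_tmul,
    Algebra.TensorProduct.tmul_mul_tmul, one_mul, mul_one, cros, LinearMap.flip_apply]

lemma cros_one_mul_cros_one (a b : A) : α.cros 1 a * α.cros 1 b = α.cros 1 (a * b) := by
  refine Eq.trans ?_ (α.proj_twist_one a b)
  rw [cros_mul_cros, twist_apply, ← Algebra.TensorProduct.one_def, one_mul]

lemma smul_cros (m n : M) (a : A) : m • α.cros n a = α.cros (m * n) a := by
  rw [cros, ← map_smul, TensorProduct.smul_tmul', smul_eq_mul]; rfl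

lemma cros_mul_cros_one (m n : M) (a : A) : α.cros m 1 * α.cros n a = α.cros (m * n) a := by
  rw [← smul_def, smul_cros]

lemma cros_eq_mul (m : M) (a : A) : α.cros m a = α.cros m 1 * α.cros 1 a := by
  rw [cros_mul_cros_one, mul_one]

lemma cros_mul_act_target (m : M) (b a : A) :
    α.cros (m * α.act (εt b) 1) a = α.cros m (εt b * a) :=
  α.proj_rel (targetMap_mem b) m a

lemma cros_one_eq : α.cros 1 1 = 1 := rfl

lemma sw_one_cros (m : M) (a : A) : sw 1 (fun x y => α.cros (α.act x m) (y * a)) = α.cros m a := by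
  have := α.cros_mul_cros_sw 1 m 1 a
  simp only [one_mul] at this
  rw [← this, cros_one_eq, one_mul]

lemma condExp_cros_mul (φ : Module.Dual ℂ A) (m : M) (x : α.CrossedProduct) :
    α.condExp φ (α.cros m 1 * x) = m * α.condExp φ x := by
  rw [← smul_def, map_smul, smul_eq_mul]

/-- Linearity on the right, unlike on the left, needs φ to be an integral: then φ ⇀ a lies in A_L,
so ((φ ⇀ a) ▷ 1)m = (φ ⇀ a) ▷ m, which matches the product rule for a ▷ (m1). -/
lemma condExp_mul_cros {φ : Module.Dual ℂ A} (hφ : IsDualLeftIntegral φ)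
    (x : α.CrossedProduct) (m : M) :
    α.condExp φ (x * α.cros m 1) = α.condExp φ x * m := by
  induction x using α.crossedProduct_induction with
  | hadd x y hx hy => rw [add_mul, map_add, map_add, add_mul, hx, hy]
  | hcros n a =>
    rw [cros_mul_cros_sw, map_sw, condExp_cros, mul_assoc]
    have hmem : hit φ a ∈ leftSub A := mem_leftSub_iff.2 ((isDualLeftIntegral_iff φ).1 hφ a)
    rw [← α.act_of_mem hmem, apply_hit φ a (fun u => n * α.act u m)]
    calc sw a (fun x y => α.condExp φ (α.cros (n * α.act x m) (y * 1)))
        = sw a (fun x p => sw p (fun y z => φ z • (n * (α.act x m * α.act y 1)))) := by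
          refine sw_congr fun x p => ?_
          rw [mul_one, condExp_cros, apply_hit φ p (fun u => n * α.act x m * α.act u 1)]
          simp only [mul_assoc]
      _ = sw a (fun p z => sw p (fun x y => φ z • (n * (α.act x m * α.act y 1)))) :=
          (sw_coassoc a (fun x y z => φ z • (n * (α.act x m * α.act y 1)))).symm
      _ = sw a (fun p z => φ z • (n * α.act p m)) := by
          refine sw_congr fun p z => ?_
          rw [← smul_sw, ← mul_sw, ← act_mul_sw, mul_one]

lemma implMap_apply (φ : Module.Dual ℂ A) (x : α.CrossedProduct) (a : A) :
    α.implMap φ x a = α.condExp φ (α.cros 1 a * x) := rfl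

lemma mem_implementers_iff {T : A →ₗ[ℂ] M} :
    T ∈ α.implementers ↔ ∀ a m, T a * m = sw a (fun x y => α.act x m * T y) := by
  have h1 : ∀ (a : A) (m : M), conv T ((counit (R := ℂ) (A := A)).smulRight m) a = T a * m := by
    intro a m
    rw [conv_eq]
    simp only [LinearMap.smulRight_apply, mul_smul_comm]
    exact sw_counit a (fun x => T x * m)
  have h2 : ∀ (a : A) (m : M), conv (α.coaction m) T a = sw a (fun x y => α.act x m * T y) :=
    fun a m => conv_eq _ _ a
  constructor
  · intro h a m
    rw [← h1, ← h2, h m]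
  · intro h m
    ext a
    rw [h1, h2, h]

/-- Bimodule linearity of Ê gives t_x(a)m = Ê(axm) = Ê(amx) = Ê((a₍₁₎ ▷ m)a₍₂₎x) = (a₍₁₎ ▷
m)t_x(a₍₂₎). -/
lemma implMap_mem_implementers {φ : Module.Dual ℂ A} (hφ : IsDualLeftIntegral φ)
    {x : α.CrossedProduct} (hx : x ∈ α.relCommutant) : α.implMap φ x ∈ α.implementers := by
  rw [mem_implementers_iff]
  intro a m
  rw [implMap_apply, ← α.condExp_mul_cros hφ, mul_assoc, ← hx m, ← mul_assoc, cros_mul_cros_sw,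
    sw_mul, map_sw]
  refine sw_congr fun p q => ?_
  rw [one_mul, mul_one, cros_eq_mul, mul_assoc, condExp_cros_mul, implMap_apply]

lemma implMap_add (φ : Module.Dual ℂ A) (x y : α.CrossedProduct) :
    α.implMap φ (x + y) = α.implMap φ x + α.implMap φ y := by
  ext a
  rw [LinearMap.add_apply, implMap_apply, implMap_apply, implMap_apply, mul_add, map_add]

/-- Because x commutes with M, zx = xz; placed on the right, z leaves Ê without being acted on by a.
-/
lemma implMap_smul {φ : Module.Dual ℂ A} (hφ : IsDualLeftIntegral φ)
    (z : Subalgebra.center ℂ M) {x : α.CrossedProduct} (hx : x ∈ α.relCommutant) :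
    α.implMap φ (z • x) = z • α.implMap φ x := by
  ext a
  have h : z • x = x * α.cros (z : M) 1 := (α.smul_def (z : M) x).trans (hx z)
  change α.condExp φ (α.cros 1 a * (z • x)) = (z : M) * α.condExp φ (α.cros 1 a * x)
  rw [h, ← mul_assoc, α.condExp_mul_cros hφ, Subalgebra.mem_center_iff.1 z.2]

lemma cros_antipode_mul_cros (a : A) (m : M) :
    α.cros 1 (S A a) * α.cros m 1 = sw a (fun x y => α.cros (α.act (S A y) m) (S A x)) := by
  rw [cros_mul_cros_sw, sw_antipode_arg a (fun u v => α.cros (1 * α.act u m) (v * 1))]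
  simp only [one_mul, mul_one]

/-- The element `S(h₍₁₎) T(h₍₂₎)` of the crossed product. -/
def ofImplementer (h : A) (T : A →ₗ[ℂ] M) : α.CrossedProduct :=
  sw h (fun x y => α.cros 1 (S A x) * α.cros (T y) 1)

section Haar

variable {h : A} {lam : Module.Dual ℂ A}

/-- On a generator m ⋊ a, commuting m past S(h₍₁₎) produces S(h₍₂₎)h₍₃₎ acting on m. This collapses
to a copy of Δ(1), and S(h₍₁₎)(λ ⇀ h₍₂₎a) = a does the rest. The argument covers the whole crossed
product, not only the relative commutant. -/
lemma ofImplementer_implMap (hh : IsHaarIntegral h) (hlam : IsIntegralDualTo lam h)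
    (x : α.CrossedProduct) : α.ofImplementer h (α.implMap lam x) = x := by
  induction x using α.crossedProduct_induction with
  | hadd x y hx hy =>
    conv_rhs => rw [← hx, ← hy]
    simp only [ofImplementer, implMap_add, LinearMap.add_apply]
    rw [sw, sw, sw, ← Finset.sum_add_distrib]
    refine Finset.sum_congr rfl fun i _ => ?_
    rw [← mul_add, (α.isLin_cros_left 1 IsLin.id).map_add]
  | hcros m a =>
    have hE : ∀ y : A, α.implMap lam (α.cros m a) y =
        sw y (fun u v => α.act u m * α.act (hit lam (v * a)) 1) := fun y => by
      rw [implMap_apply, cros_mul_cros_sw, map_sw]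
      simp only [condExp_cros, one_mul]
    have hι : ∀ y : A, α.cros (α.act (hit lam y) 1) 1 = α.cros 1 (hit lam y) := fun y => by
      have := α.cros_mul_act_target 1 (hit lam y) 1
      rwa [(isDualLeftIntegral_iff lam).1 hlam.1, one_mul, mul_one] at this
    calc α.ofImplementer h (α.implMap lam (α.cros m a))
        = sw h (fun p t => sw p (fun x y => sw t (fun u v =>
            α.cros (α.act (S A y * u) m) (S A x) * α.cros 1 (hit lam (v * a))))) := by
          refine sw_congr fun p t => ?_
          rw [hE, IsLin.map_sw (g := fun w => α.cros w 1) (by fun_prop), mul_sw, sw_comm]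
          refine sw_congr fun u v => ?_
          rw [← cros_mul_cros_one, ← mul_assoc, cros_antipode_mul_cros, sw_mul, hι]
          simp only [α.mul_act]
      _ = sw h (fun x p => sw p (fun q v => sw q (fun y u =>
            α.cros (α.act (S A y * u) m) (S A x) * α.cros 1 (hit lam (v * a))))) :=
          sw_regroup h (fun x y u v =>
            α.cros (α.act (S A y * u) m) (S A x) * α.cros 1 (hit lam (v * a)))
      _ = sw h (fun x p => sw p (fun q v =>
            α.cros (α.act (εs q) m) (S A x) * α.cros 1 (hit lam (v * a)))) :=
          sw_congr fun x p => sw_congr fun q v => (apply_sourceMap q (fun w =>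
            α.cros (α.act w m) (S A x) * α.cros 1 (hit lam (v * a)))).symm
      _ = sw h (fun x p => sw 1 (fun r s =>
            α.cros (α.act r m) (S A x) * α.cros 1 (hit lam (p * s * a)))) :=
          sw_congr fun x p => sw_source_left p (fun q v =>
            α.cros (α.act q m) (S A x) * α.cros 1 (hit lam (v * a)))
      _ = sw 1 (fun r s => α.cros (α.act r m) (s * a)) := by
          rw [sw_comm]
          refine sw_congr fun r s => ?_
          conv_rhs => rw [← hlam.sw_antipode_mul_hit hh (s * a)]
          rw [IsLin.map_sw (g := fun w => α.cros (α.act r m) w) (by fun_prop)]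
          refine sw_congr fun x p => ?_
          rw [cros_eq_mul, mul_assoc, cros_one_mul_cros_one, ← cros_eq_mul, mul_assoc]
      _ = _ := α.sw_one_cros m a

/-- Moving m to the left through T(h₍₂₎) and then S(h₍₁₎) leaves S(h₍₂₎)h₍₃₎ acting on it, that is
εs of a single leg. That leg is absorbed by 1 ⋊ 1. Only coproduct identities enter, so h may be any
element. -/
lemma ofImplementer_mem_relCommutant (h : A) {T : A →ₗ[ℂ] M} (hT : T ∈ α.implementers) :
    α.ofImplementer h T ∈ α.relCommutant := by
  intro m
  rw [mem_implementers_iff] at hT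
  symm
  calc α.ofImplementer h T * α.cros m 1
      = sw h (fun p t => sw p (fun x y => sw t (fun u v =>
          α.cros (α.act (S A y * u) m) (S A x) * α.cros (T v) 1))) := by
        rw [ofImplementer, sw_mul]
        refine sw_congr fun p t => ?_
        rw [mul_assoc, cros_mul_cros_one, hT,
          IsLin.map_sw (g := fun w => α.cros w 1) (by fun_prop), mul_sw, sw_comm]
        refine sw_congr fun u v => ?_
        rw [← cros_mul_cros_one, ← mul_assoc, cros_antipode_mul_cros, sw_mul]
        simp only [α.mul_act]
    _ = sw h (fun x p => sw p (fun q v => sw q (fun y u =>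
          α.cros (α.act (S A y * u) m) (S A x) * α.cros (T v) 1))) :=
        sw_regroup h (fun x y u v =>
          α.cros (α.act (S A y * u) m) (S A x) * α.cros (T v) 1)
    _ = sw h (fun x p => sw p (fun q v =>
          α.cros (α.act (εs q) m) (S A x) * α.cros (T v) 1)) :=
        sw_congr fun x p => sw_congr fun q v => (apply_sourceMap q (fun w =>
          α.cros (α.act w m) (S A x) * α.cros (T v) 1)).symm
    _ = sw h (fun p v => sw p (fun x q =>
          α.cros (α.act (εs q) m) (S A x) * α.cros (T v) 1)) :=
        (sw_coassoc h (fun x q v =>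
          α.cros (α.act (εs q) m) (S A x) * α.cros (T v) 1)).symm
    _ = sw h (fun p v => sw 1 (fun r s =>
          α.cros (α.act (S A s) m) (S A (p * r)) * α.cros (T v) 1)) :=
        sw_congr fun p v => sw_source_right p (fun x q =>
          α.cros (α.act q m) (S A x) * α.cros (T v) 1)
    _ = sw h (fun p v => sw 1 (fun r s =>
          α.cros (α.act (S A s) m) (S A r * S A p) * α.cros (T v) 1)) := by
        simp only [antipode_mul]
    _ = sw h (fun p v => sw 1 (fun r s =>
          α.cros (α.act r m) (s * S A p) * α.cros (T v) 1)) :=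
        sw_congr fun p v => sw_one_antipode (fun r s =>
          α.cros (α.act s m) (r * S A p) * α.cros (T v) 1)
    _ = α.cros m 1 * α.ofImplementer h T := by
        rw [ofImplementer, mul_sw]
        refine sw_congr fun p v => ?_
        rw [← sw_mul, sw_one_cros, ← mul_assoc, ← cros_eq_mul]

/-- Expanding Ê(aS(h₍₁₎)T(h₍₂₎)) gives λ(a₍₂₎S(h₍₁₎)) (a₍₁₎S(h₍₂₎) ▷ 1)T(h₍₃₎). The dual basis
identity replaces h by a₍₂₎, giving (a₍₁₎S(a₍₂₎) ▷ 1)T(a₍₃₎) = (a₍₁₎ ▷ 1)T(a₍₂₎), which is T(a) by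
the implementer relation at m = 1. -/
lemma implMap_ofImplementer (hh : IsHaarIntegral h) (hlam : IsIntegralDualTo lam h)
    {T : A →ₗ[ℂ] M} (hT : T ∈ α.implementers) :
    α.implMap lam (α.ofImplementer h T) = T := by
  rw [mem_implementers_iff] at hT
  ext a
  calc α.implMap lam (α.ofImplementer h T) a
      = sw h (fun p q => α.act (hit lam (a * S A p)) 1 * T q) := by
        rw [implMap_apply, ofImplementer, mul_sw, map_sw]
        refine sw_congr fun p q => ?_
        rw [← mul_assoc, α.condExp_mul_cros hlam.1, cros_one_mul_cros_one, condExp_cros, one_mul]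
    _ = sw h (fun p q => sw a (fun r s => sw p (fun y z =>
          lam (s * S A y) • (α.act (r * S A z) 1 * T q)))) := by
        refine sw_congr fun p q => ?_
        rw [apply_hit lam (a * S A p) (fun u => α.act u 1 * T q),
          sw_mul_arg a (S A p) (fun u v => lam v • (α.act u 1 * T q))]
        exact sw_congr fun r s => sw_antipode_arg p (fun u v =>
          lam (s * v) • (α.act (r * u) 1 * T q))
    _ = sw a (fun r s => sw h (fun y t => sw t (fun z q =>
          lam (s * S A y) • (α.act (r * S A z) 1 * T q)))) := by
        rw [sw_comm]
        exact sw_congr fun r s => sw_coassoc h (fun y z q =>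
          lam (s * S A y) • (α.act (r * S A z) 1 * T q))
    _ = sw a (fun r s => sw s (fun z q => α.act (r * S A z) 1 * T q)) := by
        refine sw_congr fun r s => ?_
        simp only [← smul_sw]
        exact hlam.sw_apply_mul_antipode hh s
          (fun t => sw t (fun z q => α.act (r * S A z) 1 * T q))
    _ = sw a (fun t q => sw t (fun r z => α.act (r * S A z) 1 * T q)) :=
        (sw_coassoc a (fun r z q => α.act (r * S A z) 1 * T q)).symm
    _ = sw a (fun t q => α.act t 1 * T q) := by
        refine sw_congr fun t q => ?_
        rw [α.act_one t]
        exact (apply_targetMap t (fun u => α.act u 1 * T q)).symm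
    _ = T a := by rw [← hT, mul_one]

/-- The isomorphism `x ↦ t_x` of the relative commutant with the inner implementers. -/
def implEquiv (hh : IsHaarIntegral h) (hlam : IsIntegralDualTo lam h) :
    α.relCommutant ≃ₗ[Subalgebra.center ℂ M] α.implementers where
  toFun x := ⟨α.implMap lam (x : α.CrossedProduct), α.implMap_mem_implementers hlam.1 x.2⟩
  map_add' x y := Subtype.ext (α.implMap_add lam x y)
  map_smul' z x := Subtype.ext (α.implMap_smul hlam.1 z x.2)
  invFun T := ⟨α.ofImplementer h (T : A →ₗ[ℂ] M), α.ofImplementer_mem_relCommutant h T.2⟩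
  left_inv x := Subtype.ext (α.ofImplementer_implMap hh hlam x)
  right_inv T := Subtype.ext (α.implMap_ofImplementer hh hlam T.2)

/-- For b in A_R, Δ(b) = 1₍₁₎ ⊗ 1₍₂₎b, so bm = (1₍₁₎ ▷ m) ⋊ 1₍₂₎b = m ⋊ b. -/
lemma oneCrosRight_subset_relCommutant :
    α.oneCrosRight ⊆ (α.relCommutant : Set α.CrossedProduct) := by
  rintro _ ⟨b, hb, rfl⟩ m
  rw [mem_rightSub_iff] at hb
  have h1 := sw_source_arg b (fun x y => α.cros (1 * α.act x m) (y * 1))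
  rw [hb] at h1
  rw [cros_mul_cros_one, mul_one, cros_mul_cros_sw, h1, ← sw_one_cros]
  simp only [one_mul, mul_one]

/-- Elements of A_R multiply only the second leg of a coproduct, so t_b is the trivial implementer
built from λ(·b), and these functionals exhaust the left integrals of the dual. -/
lemma implMap_image_oneCrosRight (hh : IsHaarIntegral h) (hlam : IsIntegralDualTo lam h) :
    α.implMap lam '' α.oneCrosRight = α.trivialImplementers := by
  have key : ∀ b ∈ rightSub A, α.implMap lam (α.cros 1 b) =
      conv (α.coaction 1) ((lam ∘ₗ LinearMap.mulRight ℂ b).smulRight (1 : M)) := by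
    intro b hb
    rw [mem_rightSub_iff] at hb
    ext a
    rw [implMap_apply, cros_one_mul_cros_one, condExp_cros, one_mul, conv_eq,
      apply_hit lam (a * b) (fun u => α.act u 1), ← hb,
      sw_mul_source_arg a b (fun x y => lam y • α.act x 1)]
    refine sw_congr fun x y => ?_
    rw [LinearMap.smulRight_apply, mul_smul_comm, mul_one]
    rfl
  ext T
  constructor
  · rintro ⟨_, ⟨b, hb, rfl⟩, rfl⟩
    exact ⟨_, (hlam.isDualLeftIntegral_iff_exists hh _).2 ⟨b, hb, rfl⟩, key b hb⟩
  · rintro ⟨mu, hmu, rfl⟩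
    obtain ⟨b, hb, rfl⟩ := (hlam.isDualLeftIntegral_iff_exists hh mu).1 hmu
    exact ⟨_, ⟨b, hb, rfl⟩, key b hb⟩

lemma centerCrosRight_eq_span :
    α.centerCrosRight = Submodule.span (Subalgebra.center ℂ M) α.oneCrosRight := by
  refine le_antisymm (Submodule.span_le.2 ?_) (Submodule.span_mono ?_)
  · rintro _ ⟨z, hz, b, hb, rfl⟩
    have h1 : α.cros z b = (⟨z, hz⟩ : Subalgebra.center ℂ M) • α.cros 1 b :=
      ((α.smul_cros z 1 b).trans (by rw [mul_one])).symm
    rw [h1]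
    exact Submodule.smul_mem _ _ (Submodule.subset_span ⟨b, hb, rfl⟩)
  · rintro _ ⟨b, hb, rfl⟩
    exact ⟨1, one_mem _, b, hb, rfl⟩

/-- The map x ↦ t_x is injective, its full image is the space of implementers, and it carries the
span of 1 ⋊ A_R onto the span of the trivial ones. Hence outerness says that this span is the whole
relative commutant. -/
lemma isOuter_iff : α.IsOuter ↔ α.relCommutant = α.centerCrosRight := by
  obtain ⟨h, hh⟩ := exists_isHaarIntegral A
  obtain ⟨lam, hlam⟩ := exists_isIntegralDualTo hh
  let e := α.implEquiv hh hlam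
  let f := α.implementers.subtype ∘ₗ e.toLinearMap
  have hf : Function.Injective f := α.implementers.injective_subtype.comp e.injective
  let N := (Submodule.span (Subalgebra.center ℂ M) α.oneCrosRight).comap α.relCommutant.subtype
  have hle := Submodule.span_le.2 α.oneCrosRight_subset_relCommutant
  have hN : N = Submodule.span (Subalgebra.center ℂ M)
      (α.relCommutant.subtype ⁻¹' α.oneCrosRight) := by
    refine Submodule.map_injective_of_injective α.relCommutant.injective_subtype ?_
    rw [Submodule.map_comap_subtype, inf_eq_right.2 hle, Submodule.map_span,
      Set.image_preimage_eq_of_subset]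
    simpa using α.oneCrosRight_subset_relCommutant
  have h1 : N.map f = Submodule.span (Subalgebra.center ℂ M) α.trivialImplementers := by
    rw [hN, Submodule.map_span, ← α.implMap_image_oneCrosRight hh hlam]
    congr 1
    ext T
    constructor
    · rintro ⟨x, hx, rfl⟩
      exact ⟨x, hx, rfl⟩
    · rintro ⟨x, hx, rfl⟩
      exact ⟨⟨x, α.oneCrosRight_subset_relCommutant hx⟩, hx, rfl⟩
  have h2 : (⊤ : Submodule (Subalgebra.center ℂ M) α.relCommutant).map f = α.implementers := by
    rw [Submodule.map_top, LinearMap.range_comp, LinearEquiv.range, Submodule.map_top,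
      Submodule.range_subtype]
  rw [IsOuter, ← h1, ← h2, (Submodule.map_injective_of_injective hf).eq_iff,
    centerCrosRight_eq_span, eq_comm, Submodule.comap_subtype_eq_top]
  exact ⟨fun h => le_antisymm h hle, fun h => h.le⟩

end Haar

end ModuleAlgebra

end WeakHopf

end

theorem theorem4p9 {A : Type*} [CStarAlgebra A] [FiniteDimensional ℂ A] [WeakCStarHopfAlgebra A]
    {M : Type*} [Ring M] [StarRing M] [Algebra ℂ M] [StarModule ℂ M]
    (α : WeakHopf.ModuleAlgebra A M) :
    -- the normalized Haar integral `h` and the left integral `lam` of the dual that is dual to `h`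
    (∃! h : A, WeakHopf.IsHaarIntegral h) ∧
    (∀ h : A, WeakHopf.IsHaarIntegral h →
      ∃! lam : Module.Dual ℂ A, WeakHopf.IsIntegralDualTo lam h) ∧
    -- `x ↦ t_x` is a `C(M)`-module isomorphism and carries `1 ⋊ A_R` onto the trivial implementers
    (∀ (h : A) (lam : Module.Dual ℂ A),
      WeakHopf.IsHaarIntegral h → WeakHopf.IsIntegralDualTo lam h →
      (∃ e : α.relCommutant ≃ₗ[Subalgebra.center ℂ M] α.implementers,
        ∀ x : α.relCommutant, (e x : A →ₗ[ℂ] M) = α.implMap lam (x : α.CrossedProduct)) ∧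
      α.oneCrosRight ⊆ (α.relCommutant : Set α.CrossedProduct) ∧
      α.implMap lam '' α.oneCrosRight = α.trivialImplementers) ∧
    -- the characterization of outerness
    (α.IsOuter ↔ α.relCommutant = α.centerCrosRight) := by
  obtain ⟨h, hh⟩ := WeakHopf.exists_isHaarIntegral A
  refine ⟨⟨h, hh, fun h' hh' => hh'.unique hh⟩, fun h' hh' => ?_, fun h' lam hh' hlam => ?_,
    α.isOuter_iff⟩
  · obtain ⟨lam, hlam⟩ := WeakHopf.exists_isIntegralDualTo hh'
    -- The equation lam ⇀ h = 1 alone already determines lam.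
    exact ⟨lam, hlam, fun mu hmu => WeakHopf.hit_injective hh' (hmu.2.trans hlam.2.symm)⟩
  · exact ⟨⟨α.implEquiv hh' hlam, fun _ => rfl⟩, α.oneCrosRight_subset_relCommutant,
      α.implMap_image_oneCrosRight hh' hlam⟩
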